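/- **Theorem (closed-form Floquet factorization).** Let $T>0$, $\omega=2\pi/T$, and let $A:\mathbb R\to\mathbb C^{n\times n}$ be $T$-periodic with $A\in L^2([0,T],\mathbb C^{n\times n})$. "Absolutely continuous" means absolutely continuous on every compact interval, and solutions of differential equations on $\mathbb R$ are in the Carathéodory sense (absolutely continuous, equation a.e.). Then $\dot x=A(t)x$ has a unique state transition matrix $\Phi(t,0)$ with $\Phi(0,0)=Id_n$. The matrix $\Phi(T,0)$ has a Jordan basis. Let $P=[\phi_1,\dots,\phi_n]$ be any Jordan basis of it, i.e. $P$ is invertible and $P^{-1}\Phi(T,0)P$ is the upper bidiagonal Jordan form with diagonal $\mu_1,\dots,\mu_n$ and with $(i,i+1)$ entry $1$ inside a Jordan block and $0$ otherwise. All $\mu_i$ are nonzero. Let $\lambda_i$ be the principal value of $\frac1T\log\mu_i$, and let $\Lambda$ be the Jordan form with $\Lambda(i,i)=\lambda_i$, $\Lambda(i,i+1)=\frac1{T\mu_i}$ inside a Jordan block, and zeros elsewhere. Call an invertible matrix $\Psi=[\psi_1,\dots,\psi_n]$ *normalized* if $\Phi(T,0)\Psi=\Psi e^{T\Lambda}$,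 i.e. if along each block with eigenvalue $\mu$ and columns $\psi_p,\psi_{p+1},\dots$ one has $\Phi(T,0)\psi_j=\sum_{k=0}^{j-p}\frac{\mu^{1-k}}{k!}\psi_{j-k}$. 1. There is a normalized $\Psi$ such that each $\psi_j-\phi_j$ is a linear combination of the $\phi_i$ with $i<j$ in the same Jordan block as $\phi_j$, and such that $\psi_j=\phi_j$ whenever $\phi_j$ is the first or the second vector of its block. In particular $\Psi=P$ if $\Phi(T,0)$ has no Jordan block of size $\ge 3$, e.g. if it is diagonalizable. 2. For every normalized $\Psi$, the initial value problems $$\dot v_j=(A(t)-\lambda_j Id_n)v_j-s_j v_{j-1},\qquad v_j(0)=\psi_j,\qquad j=1,\dots,n,$$ where $s_j=\frac{1}{T\mu_{j-1}}$ if $j-1$ and $j$ belong to the same Jordan block and $s_j=0$ otherwise, have a unique solution $(v_1,\dots,v_n)$. Each $v_j$ is $T$-periodic, and $W(t):=[v_1(t),\dots,v_n(t)]$ satisfies: * $W(t)$ is invertible for every $t$; $W$ and $W^{-1}$ are $T$-periodic and absolutely continuous; and $W,\Lambda$ give a Floquet factorization: $\Phi(t,0)=W(t)e^{t\Lambda}W(0)^{-1}$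 for all $t$; * $\dot W=AW-W\Lambda$ and $\frac{d}{dt}W^{-1}=-W^{-1}A+\Lambda W^{-1}$ almost everywhere; * for a $T$-periodic matrix function $B$ let $\mathcal T(B)$ be the $n\times n$ block matrix whose block $(i,j)$ is the Toeplitz matrix $(b_{ij,k-l})_{k,l\in\mathbb Z}$, with $b_{ij,k}=\frac1T\int_0^T b_{ij}(\tau)e^{-\mathrm i\omega k\tau}d\tau$. Put $\mathcal A=\mathcal T(A)$, $\mathcal N=Id_n\otimes\mathrm{diag}(\mathrm i\omega k,\ k\in\mathbb Z)$, and let $\mathcal I$ be the identity indexed by $\mathbb Z$. Then $\mathcal W:=\mathcal T(W)$ is a bounded operator on $\ell^2(\mathbb C^n)$ with bounded inverse, and $$\mathcal W^{-1}(\mathcal A-\mathcal N)\mathcal W=\Lambda\otimes\mathcal I-\mathcal N$$ as unbounded operators on $\ell^2(\mathbb C^n)$ (equality of domains included), where an infinite matrix acts on its maximal domain, i.e. on all $x\in\ell^2$ whose image sequence is well defined and in $\ell^2$; * a function $x:\mathbb R\to\mathbb C^n$ is a solution of $\dot x=A(t)x$ if and only if $z=W^{-1}x$ is a solution of $\dot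 z=\Lambda z$. -/

import Mathlib

open MeasureTheory
open scoped Kronecker Matrix

noncomputable section

namespace Floquet

/-! ### Carathéodory solutions -/

/-- Local absolute continuity: absolute continuity on every compact interval. -/
def LocAbsCont (f : ℝ → ℂ) : Prop :=
  ∀ a b : ℝ, AbsolutelyContinuousOnInterval f a b

/-- `x` is a solution on `ℝ`, in the Carathéodory sense, of `ẋ = A(t) x`. -/
def IsSolution {n : ℕ} (A : ℝ → Matrix (Fin n) (Fin n) ℂ) (x : ℝ → Fin n → ℂ) : Prop :=
  (∀ i, LocAbsCont (fun t => x t i)) ∧ ∀ᵐ t : ℝ, HasDerivAt x (A t *ᵥ x t) t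

/-- `Φ = Φ(·,0)` is the state transition (Wronski) matrix of `ẋ = A(t) x`: its `j`-th column is the
solution that starts at the `j`-th vector of the canonical basis. -/
def IsTransitionMatrix {n : ℕ} (A Φ : ℝ → Matrix (Fin n) (Fin n) ℂ) : Prop :=
  Φ 0 = 1 ∧ ∀ j, IsSolution A (fun t i => Φ t i j)

/-! ### Jordan forms

A Jordan form of size `n` is coded by its diagonal `μ` and by `s : Fin n → Bool`, where `s j = true`
says that column `j` continues the Jordan block of column `j - 1` (the superdiagonal entry of
column `j` is nonzero). -/

/-- Column `j` continues the Jordan block of its predecessor `i`. -/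
def Link {n : ℕ} (s : Fin n → Bool) (i j : Fin n) : Prop :=
  (i : ℕ) + 1 = j ∧ s j = true

instance {n : ℕ} (s : Fin n → Bool) (i j : Fin n) : Decidable (Link s i j) :=
  inferInstanceAs (Decidable (_ ∧ _))

/-- Upper bidiagonal matrix: diagonal `d`, entry `c i` at the linked positions `(i, i+1)`. -/
def jordanMatrix {n : ℕ} (d c : Fin n → ℂ) (s : Fin n → Bool) : Matrix (Fin n) (Fin n) ℂ :=
  Matrix.of fun i j => if i = j then d i else if Link s i j then c i else 0

/-- `P⁻¹ M P` is the Jordan normal form with eigenvalues `μ` and block structure `s`, so that the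
columns of `P` are the generalized eigenvectors `φ₁, …, φₙ` of `M`. -/
def IsJordanBasis {n : ℕ} (M : Matrix (Fin n) (Fin n) ℂ) (μ : Fin n → ℂ) (s : Fin n → Bool)
    (P : Matrix (Fin n) (Fin n) ℂ) : Prop :=
  (∀ j, s j = true → ∃ i, Link s i j ∧ μ i = μ j) ∧
    IsUnit P.det ∧ P⁻¹ * M * P = jordanMatrix μ (fun _ => 1) s

/-- `i ≤ j` belong to the same Jordan block. -/
def SameBlock {n : ℕ} (s : Fin n → Bool) (i j : Fin n) : Prop :=
  i ≤ j ∧ ∀ k, i < k → k ≤ j → s k = true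

/-- The principal value of `(1/T) log μᵢ`. -/
def floquetExponent {n : ℕ} (T : ℝ) (μ : Fin n → ℂ) (i : Fin n) : ℂ :=
  Complex.log (μ i) / T

/-- The matrix `Λ`: `Λ(i,i) = λᵢ`, `Λ(i,i+1) = 1/(T μᵢ)` inside a block, zeros elsewhere. -/
def floquetMatrix {n : ℕ} (T : ℝ) (μ : Fin n → ℂ) (s : Fin n → Bool) : Matrix (Fin n) (Fin n) ℂ :=
  jordanMatrix (floquetExponent T μ) (fun i => 1 / (T * μ i)) s

/-- The columns of `Ψ` are a basis of generalized eigenvectors of `M` on which `M` acts as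
`e^{TΛ}`. -/
def IsNormalizedBasis {n : ℕ} (T : ℝ) (M : Matrix (Fin n) (Fin n) ℂ) (μ : Fin n → ℂ)
    (s : Fin n → Bool) (Ψ : Matrix (Fin n) (Fin n) ℂ) : Prop :=
  IsUnit Ψ.det ∧ M * Ψ = Ψ * NormedSpace.exp ((T : ℂ) • floquetMatrix T μ s)

/-- The initial value problems
`v̇ⱼ = (A(t) - λⱼ) vⱼ - (1/(T μⱼ₋₁)) vⱼ₋₁`, `vⱼ(0) = ψⱼ`, where `ψⱼ` is the `j`-th column of `Ψ` and
where the last term is present only if `j` continues the Jordan block of `j - 1`. -/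
def IsFloquetSolution {n : ℕ} (T : ℝ) (A : ℝ → Matrix (Fin n) (Fin n) ℂ) (μ : Fin n → ℂ)
    (s : Fin n → Bool) (Ψ : Matrix (Fin n) (Fin n) ℂ) (v : Fin n → ℝ → Fin n → ℂ) : Prop :=
  ∀ j, v j 0 = (fun i => Ψ i j) ∧ (∀ i, LocAbsCont (fun t => v j t i)) ∧
    ∀ᵐ t : ℝ, HasDerivAt (v j)
      (A t *ᵥ v j t - floquetExponent T μ j • v j t
        - ∑ i, if Link s i j then (1 / (T * μ i)) • v i t else 0) t

/-! ### Harmonic operators on `ℓ²` -/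

/-- The `k`-th phasor `(1/T) ∫₀ᵀ a(τ) e^{-jωkτ} dτ`, `ω = 2π/T`, of a `T`-periodic function. -/
def phasor (T : ℝ) (a : ℝ → ℂ) (k : ℤ) : ℂ :=
  (1 / T) * ∫ τ in (0 : ℝ)..T, a τ * Complex.exp (-(Complex.I * (2 * Real.pi / T) * k * τ))

/-- The block Toeplitz matrix `𝒯(A)`: its block `(i,j)` is `(a_{ij,k-l})_{k,l ∈ ℤ}`. -/
def blockToeplitz {n : ℕ} (T : ℝ) (A : ℝ → Matrix (Fin n) (Fin n) ℂ) :
    Matrix (Fin n × ℤ) (Fin n × ℤ) ℂ :=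
  Matrix.of fun p q => phasor T (fun t => A t p.1 q.1) (p.2 - q.2)

/-- `𝒩 = Idₙ ⊗ diag(jωk, k ∈ ℤ)`. -/
def harmonicN (n : ℕ) (T : ℝ) : Matrix (Fin n × ℤ) (Fin n × ℤ) ℂ :=
  (1 : Matrix (Fin n) (Fin n) ℂ) ⊗ₖ
    Matrix.diagonal (fun k : ℤ => Complex.I * (2 * Real.pi / T) * k)

/-- The space `ℓ²(ℂⁿ)` of square summable families indexed by `Fin n × ℤ`. -/
abbrev EllTwo (n : ℕ) : Type := lp (fun _ : Fin n × ℤ => ℂ) 2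

/-- The (in general unbounded) operator on `ℓ²` given by an infinite matrix `M`, on its maximal
domain: all `x ∈ ℓ²` for which the sequence `M x` is defined and belongs to `ℓ²`. -/
def matrixOperator {n : ℕ} (M : Matrix (Fin n × ℤ) (Fin n × ℤ) ℂ) :
    EllTwo n →ₗ.[ℂ] EllTwo n where
  domain :=
    { carrier := {x | ∃ y : EllTwo n, ∀ p, HasSum (fun q => M p q * x q) (y p)}
      zero_mem' := ⟨0, fun p => by simp⟩
      add_mem' := by
        rintro x x' ⟨y, hy⟩ ⟨y', hy'⟩
        exact ⟨y + y', fun p => by simpa [mul_add] using (hy p).add (hy' p)⟩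
      smul_mem' := by
        rintro c x ⟨y, hy⟩
        exact ⟨c • y, fun p => by simpa [mul_left_comm] using (hy p).mul_left c⟩ }
  toFun :=
    { toFun := fun x => x.2.choose
      map_add' := fun x x' => by
        ext p
        refine (Exists.choose_spec (x + x').2 p).unique ?_
        simpa [mul_add] using (x.2.choose_spec p).add (x'.2.choose_spec p)
      map_smul' := fun c x => by
        ext p
        refine (Exists.choose_spec (c • x).2 p).unique ?_
        simpa [mul_left_comm] using (x.2.choose_spec p).mul_left c }

/-- The defining property of `matrixOperator`. -/
theorem matrixOperator_hasSum {n : ℕ} (M : Matrix (Fin n × ℤ) (Fin n × ℤ) ℂ)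
    (x : (matrixOperator M).domain) (p : Fin n × ℤ) :
    HasSum (fun q => M p q * (x : EllTwo n) q) (matrixOperator M x p) :=
  x.2.choose_spec p

/-- The bounded operator `B` on `ℓ²` is the one given by the infinite matrix `M`. -/
def IsMatrixOf {n : ℕ} (M : Matrix (Fin n × ℤ) (Fin n × ℤ) ℂ) (B : EllTwo n →L[ℂ] EllTwo n) :
    Prop :=
  ∀ x p, HasSum (fun q => M p q * x q) (B x p)

/-- The unbounded operator `B⁻¹ L B`, with domain `{x | B x ∈ dom L}`. -/
def conjugate {n : ℕ} (B : EllTwo n ≃L[ℂ] EllTwo n) (L : EllTwo n →ₗ.[ℂ] EllTwo n) :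
    EllTwo n →ₗ.[ℂ] EllTwo n where
  domain := L.domain.comap (B : EllTwo n →ₗ[ℂ] EllTwo n)
  toFun := (B.symm : EllTwo n →ₗ[ℂ] EllTwo n) ∘ₗ L.toFun ∘ₗ
    ((B : EllTwo n →ₗ[ℂ] EllTwo n).restrict (fun _ hx => hx))

end Floquet

end

namespace Floquet

/-! ### Absolutely continuous primitives -/

/-! Everything rests on the matrix `W(t) = Φ(t) Ψ e^{-tΛ}`. The initial value problems for the `vⱼ`
are the columns of `Ẇ = AW - WΛ`, `W(0) = Ψ`. If `Z` solves the adjoint equation `Ż = -ZA`, `Z(0) =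
1`, then `ZΦ` and `Z W e^{tΛ}` have derivative zero almost everywhere. Absolutely continuous
functions with this property are constant, so `Z = Φ⁻¹` and the formula for `W` is forced. Existence
of `Φ` comes from a Picard contraction in a weighted sup norm on the whole line.

Periodicity of `W` is the monodromy identity `Φ(t+T) = Φ(t)Φ(T)` combined with `Φ(T)Ψ = Ψe^{TΛ}`. A
basis `Ψ` of this kind exists because `E = e^{TΛ}` has, in each Jordan block, diagonal `μ` and first
superdiagonal `1`. It is therefore similar to the Jordan form `J` through a unipotent upper
triangular `C` with `JC = CE`, built row by row (`normalizer_support`,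
`jordanMatrix_mul_normalizer`). Jordan bases themselves come from the structure theorem for torsion
modules over `ℂ[X]`.

On the harmonic side, `W` and `V = W⁻¹` are periodic with derivatives in `L²`. Their phasors are
thus in `ℓ¹`, and remain in `ℓ²` after multiplication by the frequency. The Schur test makes the
Toeplitz matrices of `W` and `V` bounded, and the convolution theorem makes them mutually inverse.
The phasors of `AW = Ẇ + WΛ` give `(𝒜 - 𝒩)𝒲 = 𝒲(Λ ⊗ ℐ - 𝒩)` as a formal identity of infinite
matrices. Equality of domains is then a matter of absolute convergence of triple sums, settled by
moving the unbounded frequency factor onto `W` or `V` (`exists_hasSum_intertwining`,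
`eq_symm_of_hasSum_intertwining`). -/

theorem LocAbsCont.add {f g : ℝ → ℂ} (hf : LocAbsCont f) (hg : LocAbsCont g) :
    LocAbsCont (fun t => f t + g t) :=
  fun a b => (hf a b).fun_add (hg a b)

theorem LocAbsCont.mul {f g : ℝ → ℂ} (hf : LocAbsCont f) (hg : LocAbsCont g) :
    LocAbsCont (fun t => f t * g t) :=
  fun a b => (hf a b).fun_smul (hg a b)

theorem LocAbsCont.of_contDiff {f : ℝ → ℂ} (hf : ContDiff ℝ 1 f) : LocAbsCont f :=
  fun _ _ => hf.contDiffOn.absolutelyContinuousOnInterval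

theorem LocAbsCont.const (c : ℂ) : LocAbsCont (fun _ => c) :=
  .of_contDiff contDiff_const

theorem LocAbsCont.continuous {f : ℝ → ℂ} (hf : LocAbsCont f) : Continuous f := by
  rw [continuous_iff_continuousAt]
  intro t
  refine (hf (t - 1) (t + 1)).continuousOn.continuousAt ?_
  rw [Set.uIcc_of_le (by linarith)]
  exact Icc_mem_nhds (by linarith) (by linarith)

/-- `f` is locally absolutely continuous with derivative `g` almost everywhere. -/
def IsPrimitive (f g : ℝ → ℂ) : Prop :=
  LocAbsCont f ∧ ∀ᵐ t : ℝ, HasDerivAt f (g t) t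

namespace IsPrimitive

variable {f g f' g' : ℝ → ℂ}

theorem congr_ae (hf : IsPrimitive f f') (h : ∀ᵐ t : ℝ, f' t = g' t) : IsPrimitive f g' := by
  refine ⟨hf.1, ?_⟩
  filter_upwards [hf.2, h] with t h1 h2
  rwa [← h2]

theorem congr (hf : IsPrimitive f f') (h : ∀ t : ℝ, f' t = g' t) : IsPrimitive f g' :=
  hf.congr_ae (.of_forall h)

theorem add (hf : IsPrimitive f f') (hg : IsPrimitive g g') :
    IsPrimitive (fun t => f t + g t) (fun t => f' t + g' t) := by
  refine ⟨hf.1.add hg.1, ?_⟩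
  filter_upwards [hf.2, hg.2] with t h1 h2 using h1.add h2

theorem mul (hf : IsPrimitive f f') (hg : IsPrimitive g g') :
    IsPrimitive (fun t => f t * g t) (fun t => f' t * g t + f t * g' t) := by
  refine ⟨hf.1.mul hg.1, ?_⟩
  filter_upwards [hf.2, hg.2] with t h1 h2 using h1.mul h2

theorem const (c : ℂ) : IsPrimitive (fun _ => c) (fun _ => 0) :=
  ⟨.const c, .of_forall fun t => hasDerivAt_const t c⟩

theorem neg (hf : IsPrimitive f f') : IsPrimitive (fun t => -f t) (fun t => -f' t) := by
  simpa using (const (-1)).mul hf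

theorem sum {ι : Type*} (s : Finset ι) {f f' : ι → ℝ → ℂ}
    (h : ∀ i ∈ s, IsPrimitive (f i) (f' i)) :
    IsPrimitive (fun t => ∑ i ∈ s, f i t) (fun t => ∑ i ∈ s, f' i t) := by
  classical
  induction s using Finset.induction_on with
  | empty => simpa using const 0
  | insert a s ha ih =>
    simp only [Finset.sum_insert ha]
    exact (h a (by simp)).add (ih fun i hi => h i (by simp [hi]))

theorem of_hasDerivAt (h : ∀ t, HasDerivAt f (f' t) t) (hc : Continuous f') :
    IsPrimitive f f' := by
  refine ⟨.of_contDiff ?_, .of_forall h⟩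
  have hd : deriv f = f' := funext fun t => (h t).deriv
  rw [contDiff_one_iff_deriv]
  exact ⟨fun t => (h t).differentiableAt, hd ▸ hc⟩

/-- The source of every uniqueness statement below: a candidate is multiplied by a known inverse so
that the derivative of the product cancels. Absolute continuity is essential, since it excludes
Cantor-type functions. -/
theorem eq_of_deriv_zero (h : IsPrimitive f (fun _ => 0)) (a b : ℝ) : f a = f b := by
  obtain ⟨C, hC⟩ := (h.1 a b).const_of_ae_hasDerivAt_zero (h.2.mono fun t ht _ => ht)
  rw [hC a (by simp), hC b (by simp)]

theorem integral (hg : ∀ a b : ℝ, IntervalIntegrable g volume a b) :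
    IsPrimitive (fun t => ∫ τ in (0 : ℝ)..t, g τ) g := by
  refine ⟨fun a b => ?_, ?_⟩
  -- Real integrands are treated first, on an interval enlarged so as to contain the base point `0`;
  -- real and imaginary parts are then recombined.
  · have key : ∀ h : ℝ → ℝ, (∀ a b : ℝ, IntervalIntegrable h volume a b) →
        AbsolutelyContinuousOnInterval (fun t => ∫ τ in (0 : ℝ)..t, h τ) a b := by
      intro h hh
      have h0 : (0 : ℝ) ∈ Set.uIcc (min 0 (min a b)) (max 0 (max a b)) := by
        rw [Set.uIcc_of_le (by simp)]; simp
      refine ((hh _ _).absolutelyContinuousOnInterval_intervalIntegral h0).mono ?_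
      rw [Set.uIcc_of_le (by simp : min 0 (min a b) ≤ max 0 (max a b))]
      exact Set.Icc_subset_Icc (min_le_right _ _) (le_max_right _ _)
    have hre : ∀ a b : ℝ, IntervalIntegrable (fun t => (g t).re) volume a b :=
      fun a b => ⟨(hg a b).1.re, (hg a b).2.re⟩
    have him : ∀ a b : ℝ, IntervalIntegrable (fun t => (g t).im) volume a b :=
      fun a b => ⟨(hg a b).1.im, (hg a b).2.im⟩
    have h1 := (key _ hre).fun_smul ((LocAbsCont.const 1) a b)
    have h2 := (key _ him).fun_smul ((LocAbsCont.const Complex.I) a b)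
    have heq : (fun t : ℝ => ∫ τ in (0 : ℝ)..t, g τ) = fun t : ℝ =>
        (∫ τ in (0 : ℝ)..t, (g τ).re) • (1 : ℂ) + (∫ τ in (0 : ℝ)..t, (g τ).im) • Complex.I := by
      funext t
      have e1 : (∫ τ in (0 : ℝ)..t, (g τ).re) = (∫ τ in (0 : ℝ)..t, g τ).re := by
        simpa using Complex.reCLM.intervalIntegral_comp_comm (hg 0 t)
      have e2 : (∫ τ in (0 : ℝ)..t, (g τ).im) = (∫ τ in (0 : ℝ)..t, g τ).im := by
        simpa using Complex.imCLM.intervalIntegral_comp_comm (hg 0 t)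
      rw [e1, e2]
      simp
    rw [heq]
    exact h1.fun_add h2
  · have hl : LocallyIntegrable g volume := by
      intro t
      refine ⟨Set.Ioc (t - 1) (t + 1), Ioc_mem_nhds (by linarith) (by linarith), ?_⟩
      exact (hg (t - 1) (t + 1)).1
    filter_upwards [LocallyIntegrable.ae_hasDerivAt_integral hl] with t ht using ht 0

theorem eq_add_integral (h : IsPrimitive f g) (hg : ∀ a b : ℝ, IntervalIntegrable g volume a b)
    (t : ℝ) : f t = f 0 + ∫ τ in (0 : ℝ)..t, g τ := by
  have h1 := (h.add (integral hg).neg).congr (g' := fun _ => 0) (by simp)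
  have := h1.eq_of_deriv_zero t 0
  simp only [intervalIntegral.integral_same] at this
  linear_combination this

theorem continuous (h : IsPrimitive f g) : Continuous f := h.1.continuous

end IsPrimitive

/-- Entrywise version of `IsPrimitive` for matrix functions. -/
def IsMatPrimitive {m p : Type*} (F G : ℝ → Matrix m p ℂ) : Prop :=
  ∀ i j, IsPrimitive (fun t => F t i j) (fun t => G t i j)

namespace IsMatPrimitive

variable {l m p : Type*} {F F' G' : ℝ → Matrix l m ℂ}

theorem congr (hF : IsMatPrimitive F F') (h : ∀ t, F' t = G' t) : IsMatPrimitive F G' :=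
  fun i j => (hF i j).congr fun t => by rw [h t]

theorem const (C : Matrix l m ℂ) : IsMatPrimitive (fun _ => C) (fun _ => 0) :=
  fun i j => .const (C i j)

theorem mul [Fintype m] (hF : IsMatPrimitive F F') {G G' : ℝ → Matrix m p ℂ}
    (hG : IsMatPrimitive G G') :
    IsMatPrimitive (fun t => F t * G t) (fun t => F' t * G t + F t * G' t) := by
  intro i j
  simp only [Matrix.mul_apply, Matrix.add_apply]
  refine (IsPrimitive.sum Finset.univ fun k _ => (hF i k).mul (hG k j)).congr fun t => ?_
  rw [Finset.sum_add_distrib]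

theorem eq_of_deriv_zero (h : IsMatPrimitive F (fun _ => 0)) (a b : ℝ) : F a = F b := by
  ext i j
  exact (h i j).eq_of_deriv_zero a b

theorem ae_hasDerivAt [Finite l] [Finite m] (h : IsMatPrimitive F F') :
    ∀ᵐ t : ℝ, ∀ i j, HasDerivAt (fun τ => F τ i j) (F' t i j) t := by
  rw [Filter.eventually_all]
  intro i
  rw [Filter.eventually_all]
  exact fun j => (h i j).2

theorem exp_smul {n : ℕ} (M : Matrix (Fin n) (Fin n) ℂ) :
    IsMatPrimitive (fun t : ℝ => NormedSpace.exp ((t : ℂ) • M))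
      (fun t => M * NormedSpace.exp ((t : ℂ) • M)) := by
  let _ : NormedRing (Matrix (Fin n) (Fin n) ℂ) := Matrix.linftyOpNormedRing
  let _ : NormedAlgebra ℝ (Matrix (Fin n) (Fin n) ℂ) := Matrix.linftyOpNormedAlgebra
  intro i j
  let e : Matrix (Fin n) (Fin n) ℂ →L[ℝ] ℂ :=
    ⟨Matrix.entryLinearMap ℝ ℂ i j, continuous_apply_apply i j⟩
  have h := fun t : ℝ => hasDerivAt_exp_smul_const' (𝕂 := ℝ) M t
  have hc : Continuous (fun t : ℝ => NormedSpace.exp (t • M)) :=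
    continuous_iff_continuousAt.2 fun t => (h t).continuousAt
  simp only [Complex.coe_smul]
  exact .of_hasDerivAt (fun t => e.hasFDerivAt.comp_hasDerivAt t (h t))
    (e.continuous.comp (continuous_const.mul hc))

end IsMatPrimitive

/-! ### Linear equations with locally integrable coefficients -/

/-- The range of `f` lies in a compact interval, on which the `C¹` function `g` is Lipschitz; the
Lipschitz constant passes through the sums that define absolute continuity. -/
theorem _root_.AbsolutelyContinuousOnInterval.contDiff_comp {f g : ℝ → ℝ} {a b : ℝ}
    (hf : AbsolutelyContinuousOnInterval f a b) (hg : ContDiff ℝ 1 g) :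
    AbsolutelyContinuousOnInterval (fun t => g (f t)) a b := by
  obtain ⟨C, hC⟩ := hf.exists_bound
  obtain ⟨K, hK⟩ := hg.contDiffOn.exists_lipschitzOnWith (s := Set.Icc (-C) C) (by decide)
    (convex_Icc _ _) isCompact_Icc
  have hmem : ∀ x ∈ Set.uIcc a b, f x ∈ Set.Icc (-C) C := fun x hx => by
    have := hC x hx
    rwa [Real.norm_eq_abs, abs_le] at this
  have hf' := hf
  unfold AbsolutelyContinuousOnInterval at hf' ⊢
  refine squeeze_zero' (.of_forall fun _ => Finset.sum_nonneg fun _ _ => dist_nonneg) ?_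
    (by simpa using hf'.const_mul (K : ℝ))
  rw [Filter.eventually_inf_principal]
  filter_upwards with ⟨m, I⟩ hI
  rw [Finset.mul_sum]
  exact Finset.sum_le_sum fun i hi =>
    hK.dist_le_mul _ (hmem _ (hI.1 i hi).1) _ (hmem _ (hI.1 i hi).2)

/-- A weight for which integration against `α` is a contraction. -/
theorem exists_contraction_weight {α : ℝ → ℝ}
    (hα : ∀ a b : ℝ, IntervalIntegrable α volume a b) :
    ∃ w : ℝ → ℝ, Continuous w ∧ (∀ t, 1 ≤ w t) ∧
      ∀ t, |∫ τ in (0 : ℝ)..t, α τ * w τ| ≤ w t / 2 := by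
  set a : ℝ → ℝ := fun t => ∫ τ in (0 : ℝ)..t, α τ with ha
  have hac : Continuous a := intervalIntegral.continuous_primitive hα 0
  have hderiv : ∀ᵐ t : ℝ, HasDerivAt a (α t) t := by
    have hl : LocallyIntegrable α volume := by
      intro t
      exact ⟨Set.Ioc (t - 1) (t + 1), Ioc_mem_nhds (by linarith) (by linarith),
        (hα (t - 1) (t + 1)).1⟩
    filter_upwards [LocallyIntegrable.ae_hasDerivAt_integral hl] with t ht using ht 0
  -- With `w = e^{2a} + e^{-2a}` one has `(e^{2a} - e^{-2a})' = 2αw` almost everywhere. Hence the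
  -- integral of `αw` is `(e^{2a} - e^{-2a})/2`, at most `w/2` in absolute value on both sides of
  -- `0`.
  refine ⟨fun t => Real.exp (2 * a t) + Real.exp (-(2 * a t)), by fun_prop, fun t => ?_,
    fun t => ?_⟩
  · rcases le_total 0 (2 * a t) with h | h
    · linarith [Real.one_le_exp h, Real.exp_pos (-(2 * a t))]
    · linarith [Real.one_le_exp (neg_nonneg.2 h), Real.exp_pos (2 * a t)]
  · have hAC : AbsolutelyContinuousOnInterval a 0 t :=
      (hα 0 t).absolutelyContinuousOnInterval_intervalIntegral (by simp)
    have hD := hAC.contDiff_comp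
      (g := fun x => Real.exp (2 * x) - Real.exp (-(2 * x))) (by fun_prop)
    have h1 := hD.integral_deriv_eq_sub
    have h2 : ∀ᵐ τ : ℝ, deriv (fun t => Real.exp (2 * a t) - Real.exp (-(2 * a t))) τ =
        2 * (α τ * (Real.exp (2 * a τ) + Real.exp (-(2 * a τ)))) := by
      filter_upwards [hderiv] with τ hτ
      have h3 := (hτ.const_mul 2).exp.sub (hτ.const_mul 2).neg.exp
      refine (HasDerivAt.deriv h3).trans ?_
      simp only [Pi.neg_apply]
      ring
    rw [intervalIntegral.integral_congr_ae (h2.mono fun τ hτ _ => hτ),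
      intervalIntegral.integral_const_mul] at h1
    have ha0 : a 0 = 0 := by simp [ha]
    simp only [ha0, mul_zero, neg_zero, sub_self, sub_zero] at h1
    have h4 := Real.exp_pos (2 * a t)
    have h5 := Real.exp_pos (-(2 * a t))
    rw [abs_le]
    constructor <;> linarith

theorem intervalIntegrable_fun_sum {ι E : Type*} [NormedAddCommGroup E] (s : Finset ι)
    {f : ι → ℝ → E} {a b : ℝ} (h : ∀ i ∈ s, IntervalIntegrable (f i) volume a b) :
    IntervalIntegrable (fun t => ∑ i ∈ s, f i t) volume a b := by
  have := IntervalIntegrable.sum s h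
  rwa [Finset.sum_fn] at this

theorem intervalIntegrable_mulVec {n : ℕ} {A : ℝ → Matrix (Fin n) (Fin n) ℂ}
    (hA : ∀ i j, ∀ a b : ℝ, IntervalIntegrable (fun t => A t i j) volume a b)
    {x : ℝ → Fin n → ℂ} (hx : Continuous x) (i : Fin n) (a b : ℝ) :
    IntervalIntegrable (fun τ => (A τ *ᵥ x τ) i) volume a b :=
  intervalIntegrable_fun_sum Finset.univ fun j _ =>
    (hA i j a b).mul_continuousOn (g := fun τ => x τ j)
      ((continuous_apply j).comp hx).continuousOn

/-- Picard's fixed point argument, global in one stroke: with `x = w y`, `y` bounded and continuous,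
the weight makes the integral operator a contraction with constant `1/2` although `A` is only
locally integrable. -/
theorem exists_integral_solution {n : ℕ} {A : ℝ → Matrix (Fin n) (Fin n) ℂ}
    (hA : ∀ i j, ∀ a b : ℝ, IntervalIntegrable (fun t => A t i j) volume a b) (x₀ : Fin n → ℂ) :
    ∃ x : ℝ → Fin n → ℂ, Continuous x ∧
      ∀ t i, x t i = x₀ i + ∫ τ in (0 : ℝ)..t, (A τ *ᵥ x τ) i := by
  set α : ℝ → ℝ := fun t => ∑ i, ∑ j, ‖A t i j‖ with hαdef
  have hα : ∀ a b : ℝ, IntervalIntegrable α volume a b := fun a b =>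
    intervalIntegrable_fun_sum _ fun i _ => intervalIntegrable_fun_sum _ fun j _ =>
      (hA i j a b).norm
  have hbound : ∀ t (x : Fin n → ℂ) i, ‖(A t *ᵥ x) i‖ ≤ α t * ‖x‖ := by
    intro t x i
    calc ‖(A t *ᵥ x) i‖ ≤ ∑ j, ‖A t i j * x j‖ :=
          norm_sum_le (E := ℂ) Finset.univ fun j => A t i j * x j
      _ ≤ ∑ j, ‖A t i j‖ * ‖x‖ := Finset.sum_le_sum fun j _ => by
          rw [norm_mul]
          exact mul_le_mul_of_nonneg_left (norm_le_pi_norm x j) (norm_nonneg _)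
      _ = (∑ j, ‖A t i j‖) * ‖x‖ := (Finset.sum_mul _ _ _).symm
      _ ≤ α t * ‖x‖ := by
          refine mul_le_mul_of_nonneg_right ?_ (norm_nonneg _)
          exact Finset.single_le_sum (f := fun i => ∑ j, ‖A t i j‖)
            (fun i _ => Finset.sum_nonneg fun j _ => norm_nonneg _) (Finset.mem_univ i)
  have hint : ∀ x : ℝ → Fin n → ℂ, Continuous x → ∀ i, ∀ a b : ℝ,
      IntervalIntegrable (fun τ => (A τ *ᵥ x τ) i) volume a b :=
    fun x hx i a b => intervalIntegrable_mulVec hA hx i a b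
  obtain ⟨w, hwc, hw1, hw⟩ := exists_contraction_weight hα
  have hwpos : ∀ t, 0 < w t := fun t => one_pos.trans_le (hw1 t)
  have hest : ∀ (x : ℝ → Fin n → ℂ) (C : ℝ), 0 ≤ C → (∀ t, ‖x t‖ ≤ w t * C) → ∀ t i,
      ‖∫ τ in (0 : ℝ)..t, (A τ *ᵥ x τ) i‖ ≤ w t / 2 * C := by
    intro x C hC hx t i
    have hαw : IntervalIntegrable (fun τ => α τ * w τ * C) volume 0 t :=
      ((hα 0 t).mul_continuousOn hwc.continuousOn).mul_const C
    refine (intervalIntegral.norm_integral_le_abs_of_norm_le (.of_forall fun τ => ?_) hαw).trans ?_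
    · refine (hbound τ (x τ) i).trans ?_
      rw [mul_assoc]
      refine mul_le_mul_of_nonneg_left (hx τ) ?_
      exact Finset.sum_nonneg fun i _ => Finset.sum_nonneg fun j _ => norm_nonneg _
    · rw [intervalIntegral.integral_mul_const, abs_mul, abs_of_nonneg hC]
      exact mul_le_mul_of_nonneg_right (hw t) hC
  let E := BoundedContinuousFunction ℝ (Fin n → ℂ)
  let X : E → ℝ → Fin n → ℂ := fun y t => w t • y t
  have hXc : ∀ y, Continuous (X y) := fun y => hwc.smul y.continuous
  have hXb : ∀ y t, ‖X y t‖ ≤ w t * ‖y‖ := fun y t => by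
    rw [norm_smul, Real.norm_of_nonneg (hwpos t).le]
    exact mul_le_mul_of_nonneg_left (y.norm_coe_le_norm t) (hwpos t).le
  -- The Picard operator conjugated by multiplication with `w`; `1 ≤ w` keeps the contribution of
  -- `x₀` bounded.
  let R : E → ℝ → Fin n → ℂ := fun y t =>
    (w t)⁻¹ • fun i => x₀ i + ∫ τ in (0 : ℝ)..t, (A τ *ᵥ X y τ) i
  have hRc : ∀ y, Continuous (R y) := fun y =>
    (hwc.inv₀ fun t => (hwpos t).ne').smul <| continuous_pi fun i =>
      continuous_const.add (intervalIntegral.continuous_primitive (hint _ (hXc y) i) 0)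
  have hRb : ∀ y t, ‖R y t‖ ≤ ‖x₀‖ + ‖y‖ / 2 := fun y t => by
    rw [norm_smul, norm_inv, Real.norm_of_nonneg (hwpos t).le, inv_mul_le_iff₀ (hwpos t),
      pi_norm_le_iff_of_nonneg (mul_nonneg (hwpos t).le (by positivity))]
    intro i
    have h1 := hest (X y) ‖y‖ (norm_nonneg _) (hXb y) t i
    have h2 := norm_le_pi_norm x₀ i
    have h3 := le_mul_of_one_le_left (norm_nonneg x₀) (hw1 t)
    refine (norm_add_le _ _).trans ?_
    linarith
  let K : E → E := fun y => .ofNormedAddCommGroup (R y) (hRc y) _ (hRb y)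
  have hK : ContractingWith (1 / 2) K := by
    refine ⟨by rw [← NNReal.coe_lt_coe]; norm_num, LipschitzWith.of_dist_le_mul fun y z => ?_⟩
    rw [BoundedContinuousFunction.dist_le (by positivity)]
    intro t
    change dist (R y t) (R z t) ≤ _
    rw [dist_eq_norm, ← smul_sub, norm_smul, norm_inv, Real.norm_of_nonneg (hwpos t).le,
      inv_mul_le_iff₀ (hwpos t), pi_norm_le_iff_of_nonneg
        (mul_nonneg (hwpos t).le (by positivity))]
    intro i
    have h1 := hest (fun t => X y t - X z t) (dist y z) dist_nonneg (fun t => by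
      rw [← smul_sub, norm_smul, Real.norm_of_nonneg (hwpos t).le, ← dist_eq_norm]
      exact mul_le_mul_of_nonneg_left (BoundedContinuousFunction.dist_coe_le_dist t)
        (hwpos t).le) t i
    simp only [Matrix.mulVec_sub, Pi.sub_apply] at h1
    rw [intervalIntegral.integral_sub (hint _ (hXc y) i 0 t) (hint _ (hXc z) i 0 t)] at h1
    simp only [Pi.sub_apply, add_sub_add_left_eq_sub]
    refine h1.trans (le_of_eq ?_)
    push_cast
    ring
  set y := ContractingWith.fixedPoint K hK with hy
  have hfix : K y = y := hK.fixedPoint_isFixedPt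
  refine ⟨X y, hXc y, fun t i => ?_⟩
  have h1 : R y t = y t := congrArg (fun z : E => z t) hfix
  have h2 : X y t = w t • R y t := by rw [h1]
  rw [h2, smul_inv_smul₀ (hwpos t).ne']

theorem isSolution_iff {n : ℕ} {A : ℝ → Matrix (Fin n) (Fin n) ℂ} {x : ℝ → Fin n → ℂ} :
    IsSolution A x ↔ ∀ i, IsPrimitive (fun t => x t i) (fun t => (A t *ᵥ x t) i) := by
  unfold IsSolution IsPrimitive
  simp_rw [hasDerivAt_pi, Filter.eventually_all]
  exact forall_and.symm

theorem exists_isMatPrimitive {n : ℕ} {A : ℝ → Matrix (Fin n) (Fin n) ℂ}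
    (hA : ∀ i j, ∀ a b : ℝ, IntervalIntegrable (fun t => A t i j) volume a b) :
    ∃ Φ : ℝ → Matrix (Fin n) (Fin n) ℂ, Φ 0 = 1 ∧ IsMatPrimitive Φ (fun t => A t * Φ t) := by
  choose x hxc hx using fun j : Fin n => exists_integral_solution hA (Pi.single j 1)
  refine ⟨fun t => Matrix.of fun i j => x j t i, ?_, fun i j => ?_⟩
  · ext i j
    simp [hx, Matrix.one_apply, Pi.single_apply]
  · have h1 : IsPrimitive (fun t => ∫ τ in (0 : ℝ)..t, (A τ *ᵥ x j τ) i)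
        (fun t => (A t *ᵥ x j t) i) := .integral (intervalIntegrable_mulVec hA (hxc j) i)
    have h2 := (IsPrimitive.const (Pi.single (M := fun _ => ℂ) j 1 i)).add h1
    simp only [← hx, zero_add] at h2
    exact h2

/-- The fundamental matrix together with its inverse. -/
theorem exists_fundamental_pair {n : ℕ} {A : ℝ → Matrix (Fin n) (Fin n) ℂ}
    (hA : ∀ i j, ∀ a b : ℝ, IntervalIntegrable (fun t => A t i j) volume a b) :
    ∃ Φ Z : ℝ → Matrix (Fin n) (Fin n) ℂ, Φ 0 = 1 ∧ IsMatPrimitive Φ (fun t => A t * Φ t) ∧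
      IsMatPrimitive Z (fun t => -(Z t * A t)) ∧ ∀ t, Z t * Φ t = 1 := by
  obtain ⟨Φ, hΦ0, hΦ⟩ := exists_isMatPrimitive hA
  -- The transpose of a solution of `Ẏ = -AᵀY` solves `Ż = -ZA`, so `ZΦ` has zero derivative and
  -- stays equal to its value `1` at time `0`.
  obtain ⟨Y, hY0, hY⟩ := exists_isMatPrimitive (A := fun t => -(A t)ᵀ)
    (fun i j a b => (hA j i a b).neg)
  have hZ : IsMatPrimitive (fun t => (Y t)ᵀ) (fun t => -((Y t)ᵀ * A t)) := fun i j =>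
    (hY j i).congr fun t => by
      simp [Matrix.mul_apply, mul_comm]
  refine ⟨Φ, fun t => (Y t)ᵀ, hΦ0, hΦ, hZ, fun t => ?_⟩
  have h := ((hZ.mul hΦ).congr (G' := fun _ => 0) fun t => by
    simp [Matrix.mul_assoc]).eq_of_deriv_zero t 0
  simpa [hΦ0, hY0] using h

/-! ### Existence of Jordan bases -/

-- The Jordan chain is formed by the powers of `X - μ` in descending order: multiplication by `X -
-- μ` sends the `k`-th one to the `(k-1)`-st and kills the one with `k = 0`, which is `(X -
-- μ)^(e-1)`. Taylor expansion at `μ` shows that they span, and a dimension count gives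
-- independence.
open Polynomial in
theorem exists_jordan_basis_quotient (μ : ℂ) (e : ℕ) :
    ∃ b : Module.Basis (Fin e) ℂ (ℂ[X] ⧸ Ideal.span {(X - C μ) ^ e}),
      ∀ k : Fin e, (X : ℂ[X]) • b k = μ • b k +
        if h : 0 < (k : ℕ) then b ⟨k - 1, by omega⟩ else 0 := by
  set I : Ideal ℂ[X] := Ideal.span {(X - C μ) ^ e} with hI
  have hzero : Ideal.Quotient.mk I ((X - C μ) ^ e) = 0 :=
    Ideal.Quotient.eq_zero_iff_mem.2 (Ideal.mem_span_singleton_self _)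
  have hne : (X - C μ) ^ e ≠ 0 := pow_ne_zero _ (X_sub_C_ne_zero μ)
  let v : Fin e → ℂ[X] ⧸ I := fun k => Ideal.Quotient.mk I ((X - C μ) ^ (e - 1 - k))
  have hspan : ⊤ ≤ Submodule.span ℂ (Set.range v) := by
    rintro q -
    obtain ⟨p, rfl⟩ := Ideal.Quotient.mk_surjective q
    rw [← sum_taylor_eq p μ, Polynomial.sum, map_sum]
    refine Submodule.sum_mem _ fun i _ => ?_
    rcases lt_or_ge i e with hi | hi
    · have h1 : Ideal.Quotient.mk I (C ((taylor μ p).coeff i) * (X - C μ) ^ i) =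
          (taylor μ p).coeff i • v ⟨e - 1 - i, by omega⟩ := by
        rw [← smul_eq_C_mul]
        have h2 : e - 1 - (e - 1 - i) = i := by omega
        simp only [v, h2]
        rfl
      rw [h1]
      exact Submodule.smul_mem _ _ (Submodule.subset_span ⟨_, rfl⟩)
    · obtain ⟨j, rfl⟩ := Nat.exists_eq_add_of_le hi
      rw [pow_add, map_mul, map_mul, hzero]
      simp
  have hcard : Fintype.card (Fin e) = Module.finrank ℂ (ℂ[X] ⧸ I) := by
    rw [hI, finrank_quotient_span_eq_natDegree]
    simp
  refine ⟨basisOfTopLeSpanOfCardEqFinrank v hspan hcard, fun k => ?_⟩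
  have hX : ∀ q : ℂ[X], (X : ℂ[X]) • Ideal.Quotient.mk I q =
      μ • Ideal.Quotient.mk I q + Ideal.Quotient.mk I ((X - C μ) * q) := fun q => by
    have h1 : μ • Ideal.Quotient.mk I q = Ideal.Quotient.mk I (C μ * q) := by
      rw [← smul_eq_C_mul]; rfl
    have h2 : (X : ℂ[X]) • Ideal.Quotient.mk I q = Ideal.Quotient.mk I (X * q) := rfl
    rw [h1, h2, ← map_add]
    ring_nf
  simp only [coe_basisOfTopLeSpanOfCardEqFinrank, v]
  rw [hX, ← pow_succ']
  congr 1
  split_ifs with h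
  · congr 2
    omega
  · have : e - 1 - (k : ℕ) + 1 = e := by have := k.2; omega
    rw [this, hzero]

/-- `V` becomes a torsion `ℂ[X]`-module with `X` acting as `f`, hence a direct sum of quotients by
prime powers. Over `ℂ` each irreducible is associated to some `X - μ`, so every summand is a single
Jordan block. -/
theorem exists_jordan_basis {V : Type} [AddCommGroup V] [Module ℂ V] [FiniteDimensional ℂ V]
    (f : Module.End ℂ V) :
    ∃ (m : ℕ) (e : Fin m → ℕ) (ν : Fin m → ℂ) (b : Module.Basis (Σ i, Fin (e i)) ℂ V),
      ∀ i (k : Fin (e i)), f (b ⟨i, k⟩) = ν i • b ⟨i, k⟩ +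
        if h : 0 < (k : ℕ) then b ⟨i, ⟨k - 1, by omega⟩⟩ else 0 := by
  classical
  have htors : Module.IsTorsion (Polynomial ℂ) (Module.AEval' f) := by
    intro x
    obtain ⟨p, hp, hp0⟩ := (LinearMap.isIntegral f)
    refine ⟨⟨p, mem_nonZeroDivisors_of_ne_zero hp.ne_zero⟩, ?_⟩
    have h : Polynomial.aeval f p = 0 := hp0
    change p • x = 0
    have h2 := Module.AEval.of_aeval_smul (R := ℂ) (a := f) p
      ((Module.AEval'.of f).symm x)
    rw [h] at h2
    simpa using h2.symm
  obtain ⟨ι, _, p, hp, e, ⟨Θ⟩⟩ := Module.equiv_directSum_of_isTorsion htors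
  have hroot : ∀ i, ∃ μ : ℂ, Ideal.span {p i ^ e i} =
      Ideal.span {(Polynomial.X - Polynomial.C μ) ^ e i} := by
    intro i
    obtain ⟨μ, hμ⟩ := IsAlgClosed.exists_root (p i) (hp i).degree_pos.ne'
    refine ⟨μ, Ideal.span_singleton_eq_span_singleton.2 ?_⟩
    exact (((Polynomial.irreducible_X_sub_C μ).associated_of_dvd (hp i)
      (Polynomial.dvd_iff_isRoot.2 hμ)).pow_pow).symm
  choose μ hμ using hroot
  have hb : ∀ i, ∃ b : Module.Basis (Fin (e i)) ℂ
      (Polynomial ℂ ⧸ Submodule.span (Polynomial ℂ) {p i ^ e i}),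
      ∀ k : Fin (e i), (Polynomial.X : Polynomial ℂ) • b k = μ i • b k +
        if h : 0 < (k : ℕ) then b ⟨k - 1, by omega⟩ else 0 := by
    intro i
    have h := exists_jordan_basis_quotient (μ i) (e i)
    rw [← hμ i] at h
    exact h
  choose b hb using hb
  let σ := (Fintype.equivFin ι).symm
  let B : Module.Basis (Σ i, Fin (e i)) ℂ V :=
    (DFinsupp.basis b).map ((Θ.restrictScalars ℂ).symm.trans (Module.AEval'.of f).symm)
  have hB : ∀ i (k : Fin (e i)), f (B ⟨i, k⟩) = μ i • B ⟨i, k⟩ +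
        if h : 0 < (k : ℕ) then B ⟨i, ⟨k - 1, by omega⟩⟩ else 0 := by
    intro i k
    -- The inclusion of the `i`-th cyclic summand into `V`; it turns multiplication by `X` into `f`.
    let G : (Polynomial ℂ ⧸ Submodule.span (Polynomial ℂ) {p i ^ e i}) → V := fun q =>
      (Module.AEval'.of f).symm (Θ.symm (DirectSum.lof (Polynomial ℂ) ι
        (fun i => Polynomial ℂ ⧸ Submodule.span (Polynomial ℂ) {p i ^ e i}) i q))
    have hBG : ∀ k, B ⟨i, k⟩ = G (b i k) := by
      intro k
      simp only [B, Module.Basis.map_apply]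
      have h1 : DFinsupp.basis b ⟨i, k⟩ = DFinsupp.single i (b i k) := by
        simp [DFinsupp.basis]
      rw [h1]
      rfl
    have hGX : ∀ q, f (G q) = G ((Polynomial.X : Polynomial ℂ) • q) := fun q => by
      simp only [G, map_smul]
      exact (Module.AEval'.of_symm_X_smul f _).symm
    have hGa : ∀ q q', G (q + q') = G q + G q' := fun q q' => by simp [G]
    have hG0 : G 0 = 0 := by simp [G]
    have hGC : ∀ q, G (μ i • q) = μ i • G q := fun q => by
      have h1 : μ i • q = Polynomial.C (μ i) • q := by
        rw [← algebraMap_smul (Polynomial ℂ) (μ i) q]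
        rfl
      simp only [G]
      rw [h1, map_smul, map_smul, Module.AEval.C_smul, map_smul]
    simp only [hBG]
    rw [hGX, hb, hGa, hGC]
    split_ifs
    · rfl
    · rw [hG0]
  refine ⟨Fintype.card ι, fun i => e (σ i), fun i => μ (σ i),
    B.reindex (Equiv.sigmaCongrLeft (β := fun i => Fin (e i)) σ).symm, fun i k => ?_⟩
  simp only [Module.Basis.reindex_apply, Equiv.symm_symm]
  exact hB (σ i) k

theorem exists_isJordanBasis {n : ℕ} (M : Matrix (Fin n) (Fin n) ℂ) :
    ∃ (μ : Fin n → ℂ) (s : Fin n → Bool) (P : Matrix (Fin n) (Fin n) ℂ),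
      IsJordanBasis M μ s P := by
  obtain ⟨m, e, ν, b, hb⟩ := exists_jordan_basis (Matrix.toLin' M)
  have hn : ∑ i, e i = n := by
    have h1 := Module.finrank_eq_card_basis b
    simpa using h1.symm
  -- Lexicographic enumeration: the blocks are laid end to end, so neighbours within a block get
  -- consecutive indices, as `Link` requires.
  let θ : (Σ i, Fin (e i)) ≃ Fin n := finSigmaFinEquiv.trans (finCongr hn)
  have hθ : ∀ (i : Fin m) (k : Fin (e i)) (h : 0 < (k : ℕ)),
      (θ ⟨i, ⟨k - 1, by omega⟩⟩ : ℕ) + 1 = θ ⟨i, k⟩ := by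
    intro i k h
    simp only [θ, Equiv.trans_apply, finCongr_apply, Fin.val_cast, finSigmaFinEquiv_apply]
    omega
  let c := b.reindex θ
  let μ : Fin n → ℂ := fun j => ν (θ.symm j).1
  let s : Fin n → Bool := fun j => decide (0 < ((θ.symm j).2 : ℕ))
  let P : Matrix (Fin n) (Fin n) ℂ := Matrix.of fun i j => c j i
  have hs : ∀ (i : Fin m) (k : Fin (e i)), s (θ ⟨i, k⟩) = decide (0 < (k : ℕ)) := by
    intro i k
    change decide (0 < ((θ.symm (θ ⟨i, k⟩)).2 : ℕ)) = _
    rw [θ.symm_apply_apply]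
  have hlink : ∀ (i : Fin m) (k : Fin (e i)) (h : 0 < (k : ℕ)) (l : Fin n),
      Link s l (θ ⟨i, k⟩) ↔ l = θ ⟨i, ⟨k - 1, by omega⟩⟩ := by
    intro i k h l
    have h1 := hθ i k h
    simp only [Link, hs, h, decide_true, and_true, Fin.ext_iff]
    omega
  have hdet : IsUnit P.det := by
    have : P = (Pi.basisFun ℂ (Fin n)).toMatrix c := by
      ext i j
      simp [P, Module.Basis.toMatrix_apply]
    rw [this]
    have := (Pi.basisFun ℂ (Fin n)).invertibleToMatrix c
    exact Matrix.isUnit_det_of_invertible _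
  refine ⟨μ, s, P, fun j hj => ?_, hdet, ?_⟩
  · obtain ⟨⟨i, k⟩, rfl⟩ := θ.surjective j
    have hk : 0 < (k : ℕ) := by simpa [hs] using hj
    exact ⟨θ ⟨i, ⟨k - 1, by omega⟩⟩, (hlink i k hk _).2 rfl, by simp [μ]⟩
  · have hMP : M * P = P * jordanMatrix μ (fun _ => 1) s := by
      ext a j
      obtain ⟨⟨i, k⟩, rfl⟩ := θ.surjective j
      have h1 := congrFun (hb i k) a
      have h2 : (M * P) a (θ ⟨i, k⟩) = (Matrix.toLin' M (b ⟨i, k⟩)) a := by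
        simp [Matrix.mul_apply, P, c, Matrix.mulVec, dotProduct]
      rw [h2, h1, Matrix.mul_apply]
      have h3 : ∀ l, P a l * jordanMatrix μ (fun _ => 1) s l (θ ⟨i, k⟩) =
          (if l = θ ⟨i, k⟩ then ν i * b ⟨i, k⟩ a else 0) +
          if Link s l (θ ⟨i, k⟩) then P a l else 0 := by
        intro l
        by_cases hl : l = θ ⟨i, k⟩
        · subst hl
          simp [jordanMatrix, P, c, μ, Link, mul_comm]
        · simp [jordanMatrix, hl]
      simp only [h3, Finset.sum_add_distrib, Finset.sum_ite_eq', Finset.mem_univ, if_true]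
      by_cases hk : 0 < (k : ℕ)
      · simp only [hlink i k hk, Finset.sum_ite_eq', Finset.mem_univ, if_true, hk, dite_true]
        simp [P, c]
      · have : ∀ l, ¬ Link s l (θ ⟨i, k⟩) := fun l hl => hk (by simpa [hs] using hl.2)
        simp [this, hk]
    rw [Matrix.mul_assoc, hMP, Matrix.nonsing_inv_mul_cancel_left _ _ hdet]

/-! ### Powers and exponentials of Jordan matrices -/

section JordanMatrix

variable {n : ℕ} {d c : Fin n → ℂ} {s : Fin n → Bool}

theorem Link.ne {i j : Fin n} (h : Link s i j) : i ≠ j := fun e => by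
  have := h.1
  rw [e] at this
  omega

theorem Link.left_unique {i i' j : Fin n} (h : Link s i j) (h' : Link s i' j) : i = i' :=
  Fin.ext (by have := h.1; have := h'.1; omega)

theorem Link.right_unique {i j j' : Fin n} (h : Link s i j) (h' : Link s i j') : j = j' :=
  Fin.ext (by have := h.1; have := h'.1; omega)

theorem SameBlock.refl (i : Fin n) : SameBlock s i i :=
  ⟨le_rfl, fun _ h h' => absurd h (not_lt.2 h')⟩

theorem SameBlock.trans {i j k : Fin n} (h : SameBlock s i j) (h' : SameBlock s j k) :
    SameBlock s i k :=
  ⟨h.1.trans h'.1, fun l hl hl' => (le_or_gt l j).elim (fun hlj => h.2 l hl hlj)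
    fun hlj => h'.2 l hlj hl'⟩

theorem Link.sameBlock {i j : Fin n} (h : Link s i j) : SameBlock s i j := by
  have h1 := h.1
  refine ⟨Fin.le_def.2 (by omega), fun k hk hk' => ?_⟩
  have : k = j := Fin.ext (by rw [Fin.lt_def] at hk; rw [Fin.le_def] at hk'; omega)
  rw [this]
  exact h.2

theorem mul_jordanMatrix_apply {m : Type*} (F : Matrix m (Fin n) ℂ) (a : m) (j : Fin n) :
    (F * jordanMatrix d c s) a j =
      F a j * d j + ∑ l, if Link s l j then F a l * c l else 0 := by
  rw [Matrix.mul_apply]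
  have h : ∀ l, F a l * jordanMatrix d c s l j =
      (if l = j then F a j * d j else 0) + if Link s l j then F a l * c l else 0 := by
    intro l
    by_cases hl : l = j
    · subst hl
      have : ¬ Link s l l := fun h => h.ne rfl
      simp [jordanMatrix, this]
    · simp [jordanMatrix, hl]
  simp [h, Finset.sum_add_distrib]

theorem jordanMatrix_mul_apply {m : Type*} (F : Matrix (Fin n) m ℂ) (i : Fin n) (b : m) :
    (jordanMatrix d c s * F) i b =
      d i * F i b + ∑ l, if Link s i l then c i * F l b else 0 := by
  rw [Matrix.mul_apply]
  have h : ∀ l, jordanMatrix d c s i l * F l b =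
      (if i = l then d i * F i b else 0) + if Link s i l then c i * F l b else 0 := by
    intro l
    by_cases hl : i = l
    · subst hl
      have : ¬ Link s i i := fun h => h.ne rfl
      simp [jordanMatrix, this]
    · simp [jordanMatrix, hl]
  simp [h, Finset.sum_add_distrib]

theorem Link.sum_left {i j : Fin n} (h : Link s i j) (f : Fin n → ℂ) :
    (∑ l, if Link s l j then f l else 0) = f i := by
  have : ∀ l, Link s l j ↔ l = i := fun l => ⟨fun hl => hl.left_unique h, fun e => e ▸ h⟩
  simp [this]

theorem Link.sum_right {i j : Fin n} (h : Link s i j) (f : Fin n → ℂ) :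
    (∑ l, if Link s i l then f l else 0) = f j := by
  have : ∀ l, Link s i l ↔ l = j := fun l => ⟨fun hl => hl.right_unique h, fun e => e ▸ h⟩
  simp [this]

theorem jordanMatrix_pow_eq_zero {i j : Fin n} (h : ¬ SameBlock s i j) (k : ℕ) :
    (jordanMatrix d c s ^ k) i j = 0 := by
  induction k generalizing j with
  | zero =>
    have : i ≠ j := fun e => h (e ▸ SameBlock.refl i)
    simp [this]
  | succ k ih =>
    rw [pow_succ, mul_jordanMatrix_apply, ih h, zero_mul, zero_add]
    refine Finset.sum_eq_zero fun l _ => ?_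
    split_ifs with hl
    · rw [ih fun hil => h (hil.trans hl.sameBlock), zero_mul]
    · rfl

theorem jordanMatrix_pow_diag (i : Fin n) (k : ℕ) :
    (jordanMatrix d c s ^ k) i i = d i ^ k := by
  induction k with
  | zero => simp
  | succ k ih =>
    rw [pow_succ, mul_jordanMatrix_apply, ih, pow_succ]
    refine add_eq_left.2 (Finset.sum_eq_zero fun l _ => ?_)
    split_ifs with hl
    · rw [jordanMatrix_pow_eq_zero, zero_mul]
      intro h
      have h1 := h.1
      have h2 := hl.1
      rw [Fin.le_def] at h1
      omega
    · rfl

/-- The superdiagonal entry of `p(J)` is `p'(d) c`, here for `p = z^k`. The truncated exponent at `k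
= 0` is harmless because of the factor `k`. Summed over the exponential series this yields `e^d c`.
-/
theorem jordanMatrix_pow_link {i j : Fin n} (h : Link s i j) (hd : d i = d j) (k : ℕ) :
    (jordanMatrix d c s ^ k) i j = k * d i ^ (k - 1) * c i := by
  induction k with
  | zero => simp [h.ne]
  | succ k ih =>
    rw [pow_succ, mul_jordanMatrix_apply, h.sum_left fun l => (jordanMatrix d c s ^ k) i l * c l,
      ih, jordanMatrix_pow_diag, ← hd]
    rcases k with _ | k
    · simp
    · simp only [Nat.add_sub_cancel, pow_succ]
      push_cast
      ring

theorem hasSum_exp_apply (M : Matrix (Fin n) (Fin n) ℂ) (i j : Fin n) :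
    HasSum (fun k : ℕ => ((k.factorial : ℂ)⁻¹) * (M ^ k) i j) (NormedSpace.exp M i j) := by
  let _ : NormedRing (Matrix (Fin n) (Fin n) ℂ) := Matrix.linftyOpNormedRing
  let _ : NormedAlgebra ℂ (Matrix (Fin n) (Fin n) ℂ) := Matrix.linftyOpNormedAlgebra
  let e : Matrix (Fin n) (Fin n) ℂ →L[ℂ] ℂ :=
    ⟨Matrix.entryLinearMap ℂ ℂ i j, continuous_apply_apply i j⟩
  have h := e.hasSum (NormedSpace.exp_series_hasSum_exp' (𝕂 := ℂ) M)
  exact h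

theorem exp_jordanMatrix_eq_zero {i j : Fin n} (h : ¬ SameBlock s i j) :
    NormedSpace.exp (jordanMatrix d c s) i j = 0 := by
  refine (hasSum_exp_apply _ i j).unique ?_
  simp only [jordanMatrix_pow_eq_zero h, mul_zero]
  exact hasSum_zero

theorem hasSum_cexp (z : ℂ) :
    HasSum (fun k : ℕ => ((k.factorial : ℂ)⁻¹) * z ^ k) (Complex.exp z) := by
  rw [Complex.exp_eq_exp_ℂ]
  exact NormedSpace.exp_series_hasSum_exp' (𝕂 := ℂ) z

theorem exp_jordanMatrix_diag (i : Fin n) :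
    NormedSpace.exp (jordanMatrix d c s) i i = Complex.exp (d i) := by
  refine (hasSum_exp_apply _ i i).unique ?_
  simp only [jordanMatrix_pow_diag]
  exact hasSum_cexp _

theorem exp_jordanMatrix_link {i j : Fin n} (h : Link s i j) (hd : d i = d j) :
    NormedSpace.exp (jordanMatrix d c s) i j = Complex.exp (d i) * c i := by
  refine (hasSum_exp_apply _ i j).unique ?_
  simp only [jordanMatrix_pow_link h hd]
  rw [← hasSum_nat_add_iff' 1]
  simp only [Finset.sum_range_one, Nat.cast_zero, zero_mul, mul_zero, sub_zero]
  have heq : (fun k : ℕ => ((k.factorial : ℂ)⁻¹ * d i ^ k) * c i) = fun k : ℕ =>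
      ((k + 1).factorial : ℂ)⁻¹ * (((k + 1 : ℕ) : ℂ) * d i ^ (k + 1 - 1) * c i) := by
    funext k
    have h1 : (k.factorial : ℂ) ≠ 0 := Nat.cast_ne_zero.2 k.factorial_ne_zero
    have h2 : (k : ℂ) + 1 ≠ 0 := Nat.cast_add_one_ne_zero k
    rw [Nat.factorial_succ, Nat.add_sub_cancel]
    push_cast
    field_simp
  rw [← heq]
  exact (hasSum_cexp (d i)).mul_right (c i)

theorem det_eq_prod_of_support_le {C : Matrix (Fin n) (Fin n) ℂ} (hC : ∀ i j, C i j ≠ 0 → i ≤ j) :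
    C.det = ∏ i, C i i :=
  Matrix.det_of_isUpperTriangular fun i j hij => by
    by_contra h
    exact absurd (hC i j h) (not_le.2 hij)

theorem det_jordanMatrix : (jordanMatrix d c s).det = ∏ i, d i := by
  rw [det_eq_prod_of_support_le (C := jordanMatrix d c s) fun i j h => ?_]
  · simp [jordanMatrix]
  · by_contra hij
    refine h ?_
    simpa using jordanMatrix_pow_eq_zero (d := d) (c := c) (s := s) (fun hb => hij hb.1) 1

end JordanMatrix

/-! ### Normalization of a Jordan basis -/

section Normalization

variable {n : ℕ} {μ : Fin n → ℂ} {s : Fin n → Bool}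

theorem smul_floquetMatrix {T : ℝ} (hT : 0 < T) :
    (T : ℂ) • floquetMatrix T μ s =
      jordanMatrix (fun i => Complex.log (μ i)) (fun i => 1 / μ i) s := by
  have hT' : (T : ℂ) ≠ 0 := Complex.ofReal_ne_zero.2 hT.ne'
  ext i j
  simp only [floquetMatrix, jordanMatrix, floquetExponent, Matrix.smul_apply, Matrix.of_apply,
    smul_eq_mul]
  split_ifs
  · field_simp
  -- For a vanishing eigenvalue both sides are `0` by the convention on division by zero.
  · by_cases h : μ i = 0
    · simp [h]
    · field_simp
  · simp

/-- The rows of the matrix that carries a Jordan basis to a normalized one. -/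
def normalizerRow (μ : Fin n → ℂ) (s : Fin n → Bool) (E : Matrix (Fin n) (Fin n) ℂ) :
    ℕ → Fin n → ℂ
  | 0, j => if (j : ℕ) = 0 then 1 else 0
  | i + 1, j =>
    if h : i + 1 < n then
      -- Inside a block, row `i` of `JC = CE` reads `μ_i C_i + C_{i+1} = C_i E`, which is solved for
      -- row `i + 1`. A row that starts a block is free and is taken to be a unit vector.
      if s ⟨i + 1, h⟩ then
        (∑ l, normalizerRow μ s E i l * E l j) -
          μ ⟨i, (Nat.lt_succ_self i).trans h⟩ * normalizerRow μ s E i j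
      else if (j : ℕ) = i + 1 then 1 else 0
    else 0

/-- The matrix that carries a Jordan basis to a normalized one. -/
def normalizer (μ : Fin n → ℂ) (s : Fin n → Bool) (E : Matrix (Fin n) (Fin n) ℂ) :
    Matrix (Fin n) (Fin n) ℂ :=
  Matrix.of fun i j => normalizerRow μ s E i j

variable {E : Matrix (Fin n) (Fin n) ℂ}

theorem normalizer_of_link {i i' : Fin n} (h : Link s i i') (j : Fin n) :
    normalizer μ s E i' j = (normalizer μ s E * E) i j - μ i * normalizer μ s E i j := by
  obtain ⟨i, hi⟩ := i
  obtain ⟨i', hi'⟩ := i'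
  obtain ⟨h1, h2⟩ := h
  simp only at h1
  subst h1
  simp [normalizer, normalizerRow, hi', h2, Matrix.mul_apply]

theorem normalizer_of_start {i : Fin n} (h : s i = false) (j : Fin n) :
    normalizer μ s E i j = if i = j then 1 else 0 := by
  obtain ⟨i, hi⟩ := i
  cases i with
  | zero => simp [normalizer, normalizerRow, Fin.ext_iff, eq_comm]
  | succ i => simp [normalizer, normalizerRow, hi, h, Fin.ext_iff, eq_comm]

/-- Within a block `E - μ` is strictly upper triangular with ones on the superdiagonal, so each step
of the recursion moves the support one place to the right and preserves the leading coefficient `1`.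
Induction on the row index. -/
theorem normalizer_support (hs : ∀ j, s j = true → ∃ i, Link s i j ∧ μ i = μ j)
    (hE0 : ∀ i j, ¬ SameBlock s i j → E i j = 0) (hE1 : ∀ i, E i i = μ i)
    (hE2 : ∀ i j, Link s i j → E i j = 1) (i : Fin n) :
    normalizer μ s E i i = 1 ∧ ∀ j, normalizer μ s E i j ≠ 0 → SameBlock s i j := by
  obtain ⟨m, hm⟩ : ∃ m, (i : ℕ) = m := ⟨_, rfl⟩
  induction m generalizing i with
  | zero =>
    have h : s i = false := by
      by_contra h
      obtain ⟨l, hl, -⟩ := hs i (by simpa using h)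
      have := hl.1
      omega
    refine ⟨by simp [normalizer_of_start h], fun j hj => ?_⟩
    rw [normalizer_of_start h] at hj
    have : i = j := by simpa using hj
    exact this ▸ SameBlock.refl i
  | succ m ih =>
    by_cases h : s i = true
    · obtain ⟨l, hl, hμ⟩ := hs i h
      obtain ⟨h1, h2⟩ := ih l (by have := hl.1; omega)
      have hli := hl.1
      constructor
      -- By triangularity only the terms `k = l` and `k = i` survive. The first contributes `1 · E l
      -- i = 1`; the second cancels the subtracted one because `μ l = μ i`.
      · rw [normalizer_of_link hl, Matrix.mul_apply, Finset.sum_eq_add_of_mem l i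
          (Finset.mem_univ _) (Finset.mem_univ _) hl.ne, h1, hE2 l i hl, hE1, ← hμ]
        · ring
        · rintro k - ⟨hkl, hki⟩
          by_contra hk
          have hk1 := (h2 k (left_ne_zero_of_mul hk)).1
          have hk2 : k ≤ i := by
            by_contra hk2
            exact right_ne_zero_of_mul hk (hE0 k i fun hb => hk2 hb.1)
          rw [Fin.le_def] at hk1 hk2
          rw [Ne, Fin.ext_iff] at hkl hki
          omega
      · intro j hj
        rw [normalizer_of_link hl, Matrix.mul_apply] at hj
        have hlj : SameBlock s l j := by
          by_contra hlj
          refine hj ?_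
          have hz : normalizer μ s E l j = 0 := by
            by_contra hz
            exact hlj (h2 j hz)
          rw [hz, mul_zero, sub_zero]
          refine Finset.sum_eq_zero fun k _ => ?_
          by_contra hk
          have hk1 := h2 k (left_ne_zero_of_mul hk)
          exact right_ne_zero_of_mul hk (hE0 k j fun hb => hlj (hk1.trans hb))
        have hne : l ≠ j := by
          rintro rfl
          refine hj ?_
          rw [Finset.sum_eq_single l, hE1, h1]
          · ring
          · intro k _ hkl
            by_contra hk
            have hk1 := (h2 k (left_ne_zero_of_mul hk)).1
            refine right_ne_zero_of_mul hk (hE0 k l fun hb => hkl (le_antisymm hb.1 hk1))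
          · simp
        have h3 := lt_of_le_of_ne hlj.1 hne
        refine ⟨Fin.le_def.2 (by rw [Fin.lt_def] at h3; omega), fun k hk hkj => hlj.2 k ?_ hkj⟩
        rw [Fin.lt_def] at hk ⊢
        omega
    · have h : s i = false := by simpa using h
      refine ⟨by simp [normalizer_of_start h], fun j hj => ?_⟩
      rw [normalizer_of_start h] at hj
      have : i = j := by simpa using hj
      exact this ▸ SameBlock.refl i

/-- Rows with a successor in their block satisfy the identity by construction. For the last row of a
block, triangularity leaves only the diagonal entry in that row of both `C` and `E`, and both sides
are `μ` times a unit vector. -/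
theorem jordanMatrix_mul_normalizer (hs : ∀ j, s j = true → ∃ i, Link s i j ∧ μ i = μ j)
    (hE0 : ∀ i j, ¬ SameBlock s i j → E i j = 0) (hE1 : ∀ i, E i i = μ i)
    (hE2 : ∀ i j, Link s i j → E i j = 1) :
    jordanMatrix μ (fun _ => 1) s * normalizer μ s E = normalizer μ s E * E := by
  ext i j
  rw [jordanMatrix_mul_apply]
  by_cases h : ∃ i', Link s i i'
  · obtain ⟨i', h⟩ := h
    rw [h.sum_right fun l => 1 * normalizer μ s E l j, normalizer_of_link h]
    ring
  · push Not at h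
    obtain ⟨h1, h2⟩ := normalizer_support hs hE0 hE1 hE2 i
    have hb : ∀ k, SameBlock s i k → k = i := by
      intro k hk
      by_contra hne
      have hlt := lt_of_le_of_ne hk.1 (Ne.symm hne)
      rw [Fin.lt_def] at hlt
      refine h ⟨i + 1, by omega⟩ ⟨rfl, hk.2 _ ?_ ?_⟩
      · simp [Fin.lt_def]
      · simp only [Fin.le_def]
        omega
    have hrow : ∀ k, normalizer μ s E i k = if k = i then 1 else 0 := by
      intro k
      split_ifs with hk
      · rw [hk, h1]
      · by_contra hne
        exact hk (hb k (h2 k hne))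
    have hErow : E i j = if j = i then μ i else 0 := by
      split_ifs with hj
      · rw [hj, hE1]
      · exact hE0 i j fun hij => hj (hb j hij)
    simp [h, Matrix.mul_apply, hrow, hErow]

/-- Every Jordan basis can be normalized by a change of basis that is unipotent along the blocks. -/
theorem exists_isNormalizedBasis {T : ℝ} (hT : 0 < T) {M P : Matrix (Fin n) (Fin n) ℂ}
    (hP : IsJordanBasis M μ s P) (hμ : ∀ i, μ i ≠ 0) :
    ∃ C : Matrix (Fin n) (Fin n) ℂ, (∀ i, C i i = 1) ∧
      (∀ i j, i ≠ j → C i j ≠ 0 → SameBlock s i j ∧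
        ∃ k : Fin n, SameBlock s k j ∧ (k : ℕ) + 2 ≤ j) ∧
      IsNormalizedBasis T M μ s (P * C) := by
  obtain ⟨hs, hdet, hPM⟩ := hP
  set E := NormedSpace.exp ((T : ℂ) • floquetMatrix T μ s) with hE
  rw [smul_floquetMatrix hT] at hE
  have hE0 : ∀ i j, ¬ SameBlock s i j → E i j = 0 := fun i j h => by
    rw [hE, exp_jordanMatrix_eq_zero h]
  have hE1 : ∀ i, E i i = μ i := fun i => by
    rw [hE, exp_jordanMatrix_diag, Complex.exp_log (hμ i)]
  -- This explains the entry `1/(Tμ)` of `Λ`: the superdiagonal of `e^{TΛ}` is `e^{log μ} · (1/μ) =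
  -- 1`, as in the Jordan form.
  have hE2 : ∀ i j, Link s i j → E i j = 1 := fun i j h => by
    obtain ⟨i', h', hi'⟩ := hs j h.2
    rw [h'.left_unique h] at hi'
    rw [hE, exp_jordanMatrix_link h (by rw [hi']), Complex.exp_log (hμ i),
      mul_one_div_cancel (hμ i)]
  have hsup := normalizer_support hs hE0 hE1 hE2
  refine ⟨normalizer μ s E, fun i => (hsup i).1, fun i j hij hC => ?_, ?_, ?_⟩
  · have hb := (hsup i).2 j hC
    refine ⟨hb, ?_⟩
    -- A block start has a unit row in `C`, so a nonzero off-diagonal entry forces a predecessor `k`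
    -- of `i`. Then `k + 1 = i < j`, and the first two vectors of a block are never corrected.
    have hi : s i = true := by
      by_contra hi
      rw [normalizer_of_start (by simpa using hi)] at hC
      simp [hij] at hC
    obtain ⟨k, hk, -⟩ := hs i hi
    refine ⟨k, hk.sameBlock.trans hb, ?_⟩
    have h1 := lt_of_le_of_ne hb.1 hij
    have h2 := hk.1
    rw [Fin.lt_def] at h1
    omega
  · rw [Matrix.det_mul,
      det_eq_prod_of_support_le fun i j h => ((hsup i).2 j h).1]
    simpa [(hsup _).1] using hdet
  · have hMP : M * P = P * jordanMatrix μ (fun _ => 1) s := by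
      rw [← hPM, Matrix.mul_assoc, Matrix.mul_nonsing_inv_cancel_left _ _ hdet]
    rw [← Matrix.mul_assoc, hMP, Matrix.mul_assoc, Matrix.mul_assoc,
      jordanMatrix_mul_normalizer hs hE0 hE1 hE2]

theorem IsJordanBasis.eigenvalue_ne_zero {M P : Matrix (Fin n) (Fin n) ℂ}
    (hP : IsJordanBasis M μ s P) (hM : M.det ≠ 0) (i : Fin n) : μ i ≠ 0 := by
  obtain ⟨-, hdet, hPM⟩ := hP
  have h := congrArg Matrix.det hPM
  rw [det_jordanMatrix, Matrix.det_mul, Matrix.det_mul] at h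
  have h1 : P⁻¹.det ≠ 0 := (Matrix.isUnit_nonsing_inv_det _ hdet).ne_zero
  have h2 : ∏ i, μ i ≠ 0 := h ▸ mul_ne_zero (mul_ne_zero h1 hM) hdet.ne_zero
  exact Finset.prod_ne_zero_iff.1 h2 i (Finset.mem_univ i)

end Normalization

/-! ### Floquet factorization -/

/-- The integral representation transports absolute continuity and the almost everywhere derivative
together. -/
theorem IsPrimitive.comp_add_right {f g : ℝ → ℂ} (h : IsPrimitive f g)
    (hg : ∀ a b : ℝ, IntervalIntegrable g volume a b) (T : ℝ) :
    IsPrimitive (fun t => f (t + T)) (fun t => g (t + T)) := by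
  have hg' : ∀ a b : ℝ, IntervalIntegrable (fun t => g (t + T)) volume a b := fun a b => by
    simpa using (hg (a + T) (b + T)).comp_add_right T
  have h1 := (IsPrimitive.const (f T)).add (IsPrimitive.integral hg')
  simp only [zero_add] at h1
  have h2 : (fun t => f (t + T)) = fun t => f T + ∫ τ in (0 : ℝ)..t, g (τ + T) := by
    funext t
    rw [h.eq_add_integral hg (t + T), h.eq_add_integral hg T,
      intervalIntegral.integral_comp_add_right, zero_add, add_assoc,
      intervalIntegral.integral_add_adjacent_intervals (hg _ _) (hg _ _)]
  rwa [h2]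

/-! ### Exponentials of multiples of one matrix -/

section Exp

variable {n : ℕ} (M : Matrix (Fin n) (Fin n) ℂ)

theorem exp_smul_mul_self (t : ℂ) :
    NormedSpace.exp (t • M) * M = M * NormedSpace.exp (t • M) := by
  let _ : NormedRing (Matrix (Fin n) (Fin n) ℂ) := Matrix.linftyOpNormedRing
  let _ : NormedAlgebra ℚ (Matrix (Fin n) (Fin n) ℂ) := Matrix.linftyOpNormedAlgebra
  exact ((Commute.refl M).smul_left t).exp_left

theorem exp_add_smul (t u : ℂ) :
    NormedSpace.exp ((t + u) • M) = NormedSpace.exp (t • M) * NormedSpace.exp (u • M) := by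
  rw [add_smul, Matrix.exp_add_of_commute]
  exact ((Commute.refl M).smul_left t).smul_right u

theorem exp_smul_mul_exp_neg_smul (t : ℂ) :
    NormedSpace.exp (t • M) * NormedSpace.exp ((-t) • M) = 1 := by
  rw [← exp_add_smul]
  simp

theorem isMatPrimitive_exp_neg_smul :
    IsMatPrimitive (fun t : ℝ => NormedSpace.exp ((-(t : ℂ)) • M))
      (fun t => -(NormedSpace.exp ((-(t : ℂ)) • M) * M)) := by
  have h := IsMatPrimitive.exp_smul (-M)
  simp only [smul_neg, ← neg_smul] at h
  exact h.congr fun t => by rw [exp_smul_mul_self, Matrix.neg_mul]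

end Exp

/-! ### Transition matrix, monodromy and the equation of the periodic factor -/

section Transition

variable {n : ℕ} {A Φ : ℝ → Matrix (Fin n) (Fin n) ℂ}

theorem isTransitionMatrix_iff :
    IsTransitionMatrix A Φ ↔ Φ 0 = 1 ∧ IsMatPrimitive Φ (fun t => A t * Φ t) := by
  refine and_congr_right fun _ => ?_
  simp only [isSolution_iff]
  exact forall_comm

variable (hA : ∀ i j, ∀ a b : ℝ, IntervalIntegrable (fun t => A t i j) volume a b)
include hA

theorem intervalIntegrable_mul {m : Type*} {X : ℝ → Matrix (Fin n) m ℂ}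
    (hX : ∀ i j, Continuous fun t => X t i j) (i : Fin n) (j : m) (a b : ℝ) :
    IntervalIntegrable (fun t => (A t * X t) i j) volume a b :=
  intervalIntegrable_fun_sum Finset.univ fun k _ =>
    (hA i k a b).mul_continuousOn (hX k j).continuousOn

theorem existsUnique_isTransitionMatrix : ∃! Φ, IsTransitionMatrix A Φ := by
  obtain ⟨Φ, Z, h0, hΦ, hZ, hZΦ⟩ := exists_fundamental_pair hA
  refine ⟨Φ, isTransitionMatrix_iff.2 ⟨h0, hΦ⟩, fun X hX => funext fun t => ?_⟩
  obtain ⟨hX0, hX⟩ := isTransitionMatrix_iff.1 hX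
  have h := ((hZ.mul hX).congr (G' := fun _ => 0) fun t => by
    simp [Matrix.mul_assoc]).eq_of_deriv_zero t 0
  have hZ0 : Z 0 = 1 := by simpa [h0] using hZΦ 0
  rw [hX0, hZ0, Matrix.mul_one] at h
  rw [← Matrix.one_mul (X t), ← mul_eq_one_comm.1 (hZΦ t), Matrix.mul_assoc, h,
    Matrix.mul_one]

theorem IsTransitionMatrix.exists_inverse (hΦ : IsTransitionMatrix A Φ) :
    ∃ Z : ℝ → Matrix (Fin n) (Fin n) ℂ, IsMatPrimitive Z (fun t => -(Z t * A t)) ∧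
      Z 0 = 1 ∧ ∀ t, Z t * Φ t = 1 := by
  obtain ⟨Φ', Z, h0, hΦ', hZ, hZΦ⟩ := exists_fundamental_pair hA
  obtain rfl := (existsUnique_isTransitionMatrix hA).unique hΦ
    (isTransitionMatrix_iff.2 ⟨h0, hΦ'⟩)
  exact ⟨Z, hZ, by simpa [h0] using hZΦ 0, hZΦ⟩

/-- By periodicity of `A` the shifted matrix solves the same equation, so `Z(t)Φ(t+T)` is constant,
equal to its value `Φ(T)` at `t = 0`. -/
theorem IsTransitionMatrix.add_period (hΦ : IsTransitionMatrix A Φ) {T : ℝ}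
    (hper : Function.Periodic A T) (t : ℝ) : Φ (t + T) = Φ t * Φ T := by
  obtain ⟨Z, hZ, hZ0, hZΦ⟩ := hΦ.exists_inverse hA
  obtain ⟨h0, hΦ⟩ := isTransitionMatrix_iff.1 hΦ
  have hX : IsMatPrimitive (fun t => Φ (t + T)) (fun t => A t * Φ (t + T)) := fun i j =>
    ((hΦ i j).comp_add_right
      (intervalIntegrable_mul hA (fun i j => (hΦ i j).continuous) i j) T).congr
      fun t => by change (A (t + T) * Φ (t + T)) i j = _; rw [hper t]
  have h := ((hZ.mul hX).congr (G' := fun _ => 0) fun t => by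
    simp [Matrix.mul_assoc]).eq_of_deriv_zero t 0
  rw [hZ0, Matrix.one_mul, zero_add] at h
  rw [← h, ← Matrix.mul_assoc, mul_eq_one_comm.1 (hZΦ t), Matrix.one_mul]

variable {Ψ Λ : Matrix (Fin n) (Fin n) ℂ}

/-- Existence and uniqueness at once: in `Z W e^{tΛ}` the left factor absorbs `AW` and the right
factor absorbs `-WΛ`, so this product keeps its initial value `Ψ`. -/
theorem IsTransitionMatrix.isMatPrimitive_floquet_iff (hΦ : IsTransitionMatrix A Φ)
    {W : ℝ → Matrix (Fin n) (Fin n) ℂ} :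
    (W 0 = Ψ ∧ IsMatPrimitive W (fun t => A t * W t - W t * Λ)) ↔
      ∀ t : ℝ, W t = Φ t * Ψ * NormedSpace.exp ((-(t : ℂ)) • Λ) := by
  obtain ⟨Z, hZ, hZ0, hZΦ⟩ := hΦ.exists_inverse hA
  obtain ⟨h0, hΦ⟩ := isTransitionMatrix_iff.1 hΦ
  constructor
  · rintro ⟨hW0, hW⟩ t
    have h := (((hZ.mul hW).mul (IsMatPrimitive.exp_smul Λ)).congr (G' := fun _ => 0) fun t => by
      noncomm_ring).eq_of_deriv_zero t 0
    simp only [hZ0, hW0, Complex.ofReal_zero, zero_smul, NormedSpace.exp_zero, Matrix.one_mul,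
      Matrix.mul_one] at h
    rw [← h]
    calc W t = (Φ t * Z t) * W t *
          (NormedSpace.exp ((t : ℂ) • Λ) * NormedSpace.exp ((-(t : ℂ)) • Λ)) := by
          rw [mul_eq_one_comm.1 (hZΦ t), exp_smul_mul_exp_neg_smul]
          simp
      _ = _ := by simp only [Matrix.mul_assoc]
  · intro h
    have hW : W = fun t : ℝ => Φ t * Ψ * NormedSpace.exp ((-(t : ℂ)) • Λ) := funext h
    refine ⟨by simp [h, h0], ?_⟩
    rw [hW]
    exact ((hΦ.mul (IsMatPrimitive.const Ψ)).mul (isMatPrimitive_exp_neg_smul Λ)).congr fun t => by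
      noncomm_ring

end Transition

/-- The terms in `λⱼ` and `vⱼ₋₁` are together the `j`-th column of `WΛ`, since `Λ` is bidiagonal. -/
theorem isFloquetSolution_iff {n : ℕ} {T : ℝ} {A : ℝ → Matrix (Fin n) (Fin n) ℂ}
    {μ : Fin n → ℂ} {s : Fin n → Bool} {Ψ : Matrix (Fin n) (Fin n) ℂ}
    {v : Fin n → ℝ → Fin n → ℂ} {W : ℝ → Matrix (Fin n) (Fin n) ℂ}
    (hW : ∀ t i j, W t i j = v j t i) :
    IsFloquetSolution T A μ s Ψ v ↔
      W 0 = Ψ ∧ IsMatPrimitive W (fun t => A t * W t - W t * floquetMatrix T μ s) := by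
  have key : ∀ j t i, (A t *ᵥ v j t - floquetExponent T μ j • v j t
        - ∑ l, if Link s l j then (1 / (T * μ l)) • v l t else 0) i =
      (A t * W t - W t * floquetMatrix T μ s) i j := by
    intro j t i
    rw [Matrix.sub_apply, floquetMatrix, mul_jordanMatrix_apply]
    simp only [Pi.sub_apply, Finset.sum_apply, hW, Matrix.mul_apply, Matrix.mulVec, dotProduct,
      Pi.smul_apply, smul_eq_mul]
    have : ∀ l, (if Link s l j then (1 / ((T : ℂ) * μ l)) • v l t else 0) i =
        if Link s l j then v l t i * (1 / (T * μ l)) else 0 := by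
      intro l
      split_ifs <;> simp [mul_comm]
    simp only [this]
    ring
  unfold IsFloquetSolution IsMatPrimitive IsPrimitive
  simp_rw [hasDerivAt_pi, key, Filter.eventually_all, ← hW]
  constructor
  · intro h
    refine ⟨?_, fun i j => ⟨(h j).2.1 i, (h j).2.2 i⟩⟩
    ext i j
    have := congrFun (h j).1 i
    rwa [← hW] at this
  · rintro ⟨h0, h⟩ j
    refine ⟨?_, fun i => (h i j).1, fun i => (h i j).2⟩
    funext i
    rw [← hW, h0]

/-! ### Phasors -/

section Phasor

variable {T : ℝ}

theorem norm_cexp_phasor (k : ℤ) (t : ℝ) :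
    ‖Complex.exp (-(Complex.I * (2 * Real.pi / T) * k * t))‖ = 1 := by
  have : -(Complex.I * (2 * Real.pi / T) * k * t) =
      ((-(2 * Real.pi / T * k * t) : ℝ) : ℂ) * Complex.I := by
    push_cast
    ring
  rw [this, Complex.norm_exp_ofReal_mul_I]

theorem continuous_cexp_phasor (k : ℤ) :
    Continuous fun t : ℝ => Complex.exp (-(Complex.I * (2 * Real.pi / T) * k * t)) := by
  fun_prop

theorem phasor_add {a b : ℝ → ℂ} (ha : IntervalIntegrable a volume 0 T)
    (hb : IntervalIntegrable b volume 0 T) (k : ℤ) :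
    phasor T (fun t => a t + b t) k = phasor T a k + phasor T b k := by
  simp only [phasor, add_mul]
  rw [intervalIntegral.integral_add
    (ha.mul_continuousOn (continuous_cexp_phasor k).continuousOn)
    (hb.mul_continuousOn (continuous_cexp_phasor k).continuousOn), mul_add]

theorem phasor_zero (k : ℤ) : phasor T (fun _ => 0) k = 0 := by
  simp [phasor]

theorem phasor_mul_const (a : ℝ → ℂ) (c : ℂ) (k : ℤ) :
    phasor T (fun t => a t * c) k = phasor T a k * c := by
  simp only [phasor, mul_right_comm _ c, intervalIntegral.integral_mul_const]
  ring

theorem phasor_sum {ι : Type*} (s : Finset ι) {a : ι → ℝ → ℂ}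
    (ha : ∀ i ∈ s, IntervalIntegrable (a i) volume 0 T) (k : ℤ) :
    phasor T (fun t => ∑ i ∈ s, a i t) k = ∑ i ∈ s, phasor T (a i) k := by
  classical
  induction s using Finset.induction_on with
  | empty => simpa using phasor_zero k
  | insert i s hi ih =>
    simp only [Finset.sum_insert hi]
    rw [phasor_add (ha i (by simp))
      (intervalIntegrable_fun_sum _ fun j hj => ha j (by simp [hj])),
      ih fun j hj => ha j (by simp [hj])]

theorem phasor_eq_fourierCoeffOn (hT : 0 < T) (a : ℝ → ℂ) (k : ℤ) :
    phasor T a k = fourierCoeffOn hT a k := by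
  rw [fourierCoeffOn_eq_integral, phasor, sub_zero]
  rw [Complex.real_smul]
  push_cast
  congr 1
  refine intervalIntegral.integral_congr fun t _ => ?_
  simp only [fourier_coe_apply, smul_eq_mul]
  rw [mul_comm]
  congr 2
  push_cast
  ring

theorem summable_sq_phasor (hT : 0 < T) {a : ℝ → ℂ}
    (ha : MemLp a 2 (volume.restrict (Set.Icc 0 T))) :
    Summable fun k => ‖phasor T a k‖ ^ 2 := by
  simp only [phasor_eq_fourierCoeffOn hT]
  exact (hasSum_sq_fourierCoeffOn hT
    (ha.mono_measure (Measure.restrict_mono Set.Ioc_subset_Icc_self le_rfl))).summable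

/-- The phasors of the derivative of a periodic absolutely continuous function. -/
theorem IsPrimitive.phasor_deriv (hT : 0 < T) {f g : ℝ → ℂ} (h : IsPrimitive f g)
    (hg : ∀ a b : ℝ, IntervalIntegrable g volume a b) (hper : f T = f 0) (k : ℤ) :
    phasor T g k = Complex.I * (2 * Real.pi / T) * k * phasor T f k := by
  set c : ℂ := -(Complex.I * (2 * Real.pi / T) * k) with hc
  have he : IsPrimitive (fun t : ℝ => Complex.exp (c * t))
      (fun t : ℝ => Complex.exp (c * t) * c) := by
    refine .of_hasDerivAt (fun t => ?_) (by fun_prop)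
    have h1 : HasDerivAt (fun t : ℝ => c * (t : ℂ)) c t := by
      simpa using (Complex.ofRealCLM.hasDerivAt (x := t)).const_mul c
    exact h1.cexp
  have hec : Continuous fun t : ℝ => Complex.exp (c * t) := by fun_prop
  have hi1 : ∀ a b : ℝ, IntervalIntegrable (fun t => g t * Complex.exp (c * t)) volume a b :=
    fun a b => (hg a b).mul_continuousOn hec.continuousOn
  have hi2 : ∀ a b : ℝ,
      IntervalIntegrable (fun t => f t * (Complex.exp (c * t) * c)) volume a b :=
    fun a b => (h.continuous.mul (hec.mul continuous_const)).intervalIntegrable a b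
  have hcT : Complex.exp (c * T) = 1 := by
    rw [Complex.exp_eq_one_iff]
    refine ⟨-k, ?_⟩
    have : (T : ℂ) ≠ 0 := Complex.ofReal_ne_zero.2 hT.ne'
    rw [hc]
    push_cast
    field_simp
  -- Integration by parts: `f e^{ct}` takes the same value at `0` and `T`, so its derivative
  -- integrates to zero over a period.
  have hint := (h.mul he).eq_add_integral (fun a b => (hi1 a b).add (hi2 a b)) T
  rw [intervalIntegral.integral_add (hi1 0 T) (hi2 0 T), hcT, hper] at hint
  simp only [Complex.ofReal_zero, mul_zero, Complex.exp_zero, mul_one] at hint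
  have hz := left_eq_add.1 hint
  simp only [← mul_assoc, intervalIntegral.integral_mul_const] at hz
  have hexp : ∀ t : ℝ, Complex.exp (-(Complex.I * (2 * Real.pi / T) * k * t)) =
      Complex.exp (c * t) := fun t => by rw [hc]; ring_nf
  simp only [phasor, hexp]
  have hc' : Complex.I * (2 * Real.pi / T) * k = -c := by rw [hc, neg_neg]
  rw [hc']
  linear_combination (1 / (T : ℂ)) * hz

theorem phasor_const (hT : 0 < T) (c : ℂ) (k : ℤ) :
    phasor T (fun _ => c) k = if k = 0 then c else 0 := by
  have hT' : (T : ℂ) ≠ 0 := Complex.ofReal_ne_zero.2 hT.ne'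
  split_ifs with hk
  · simp [phasor, hk, hT']
  · have h := (IsPrimitive.const c).phasor_deriv hT (fun a b => by simp) rfl k
    rw [phasor_zero, eq_comm, mul_eq_zero] at h
    refine h.resolve_left ?_
    have hπ : (Real.pi : ℂ) ≠ 0 := Complex.ofReal_ne_zero.2 Real.pi_ne_zero
    simp [hk, hT', hπ]

/-- For `k ≠ 0`, `|f_k| ≤ (|ωk f_k|² + 1/(ωk)²)/2`; the first term is summable by Parseval for the
derivative. -/
theorem IsPrimitive.summable_phasor (hT : 0 < T) {f g : ℝ → ℂ} (h : IsPrimitive f g)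
    (hg : ∀ a b : ℝ, IntervalIntegrable g volume a b)
    (hg2 : MemLp g 2 (volume.restrict (Set.Icc 0 T))) (hper : f T = f 0) :
    Summable fun k => ‖phasor T f k‖ := by
  have h1 := summable_sq_phasor hT hg2
  have h2 : Summable fun k : ℤ => (1 / (2 * Real.pi / T)) ^ 2 * (1 / (k : ℝ) ^ 2) :=
    (Real.summable_one_div_int_pow.2 (by norm_num)).mul_left _
  refine Summable.of_norm_bounded_eventually ((h1.add h2).div_const 2) ?_
  have h0 : ∀ᶠ k : ℤ in Filter.cofinite, k ≠ 0 := by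
    rw [Filter.eventually_cofinite]
    simp
  filter_upwards [h0] with k hk
  rw [h.phasor_deriv hT hg hper k]
  have hω : 0 < 2 * Real.pi / T := by positivity
  have hk' : (k : ℝ) ≠ 0 := Int.cast_ne_zero.2 hk
  have hnorm : ‖Complex.I * (2 * Real.pi / T) * k * phasor T f k‖ =
      2 * Real.pi / T * |(k : ℝ)| * ‖phasor T f k‖ := by
    rw [norm_mul, norm_mul, norm_mul, Complex.norm_I, one_mul, Complex.norm_intCast]
    congr 2
    rw [← Complex.ofReal_ofNat, ← Complex.ofReal_mul, ← Complex.ofReal_div,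
      Complex.norm_of_nonneg hω.le]
  rw [hnorm, norm_norm]
  set ω := 2 * Real.pi / T
  set x := ‖phasor T f k‖
  have h3 : (1 / ω) ^ 2 * (1 / (k : ℝ) ^ 2) = (1 / (ω * |(k : ℝ)|)) ^ 2 := by
    rw [div_pow 1 (ω * _), mul_pow, sq_abs, one_pow, div_pow, one_pow, div_mul_div_comm, one_mul]
  have h4 : 0 < ω * |(k : ℝ)| := by positivity
  rw [h3, le_div_iff₀ two_pos]
  have h5 := two_mul_le_add_sq (ω * |(k : ℝ)| * x) (1 / (ω * |(k : ℝ)|))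
  have h6 : 2 * (ω * |(k : ℝ)| * x) * (1 / (ω * |(k : ℝ)|)) = x * 2 := by
    field_simp
  rw [h6] at h5
  exact h5

theorem hasSum_phasor_mul_exp (hT : 0 < T) {f : ℝ → ℂ} (hf : Continuous f)
    (hper : Function.Periodic f T) (hs : Summable fun k => ‖phasor T f k‖) (t : ℝ) :
    HasSum (fun m : ℤ => phasor T f m * Complex.exp (Complex.I * (2 * Real.pi / T) * m * t))
      (f t) := by
  have : Fact (0 < T) := ⟨hT⟩
  let F : C(AddCircle T, ℂ) := ⟨hper.lift, continuous_coinduced_dom.2 hf⟩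
  have hF : ∀ t : ℝ, F t = f t := fun t => hper.lift_coe t
  have hcoef : ∀ m, fourierCoeff F m = phasor T f m := by
    intro m
    rw [fourierCoeff_eq_intervalIntegral _ _ 0, phasor, Complex.real_smul, zero_add]
    push_cast
    congr 1
    refine intervalIntegral.integral_congr fun t _ => ?_
    simp only [fourier_coe_apply, smul_eq_mul, hF]
    rw [mul_comm]
    congr 2
    push_cast
    ring
  have h := has_pointwise_sum_fourier_series_of_summable (f := F)
    (by simpa only [funext hcoef] using hs.of_norm) t
  rw [hF] at h
  have heq : (fun m : ℤ => fourierCoeff F m • fourier m (t : AddCircle T)) =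
      fun m : ℤ => phasor T f m * Complex.exp (Complex.I * (2 * Real.pi / T) * m * t) := by
    funext m
    rw [fourier_coe_apply, hcoef, smul_eq_mul]
    congr 2
    ring
  rwa [heq] at h

/-- The phasors of a product are the convolution of the phasors. -/
theorem hasSum_phasor_mul (hT : 0 < T) {a f : ℝ → ℂ} (ha : IntervalIntegrable a volume 0 T)
    (hf : Continuous f) (hper : Function.Periodic f T)
    (hs : Summable fun k => ‖phasor T f k‖) (k : ℤ) :
    HasSum (fun m : ℤ => phasor T a (k - m) * phasor T f m) (phasor T (fun t => a t * f t) k) := by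
  -- The Fourier series of `f` is inserted and integrated termwise. The norms `|f_m| |a(t)|` have
  -- summable integrals, so `a` need only be integrable.
  let F : ℤ → ℝ → ℂ := fun m t =>
    phasor T f m * (a t * Complex.exp (-(Complex.I * (2 * Real.pi / T) * (k - m : ℤ) * t)))
  have hint : ∀ m, Integrable (F m) (volume.restrict (Set.Ioc 0 T)) := fun m =>
    ((ha.mul_continuousOn (continuous_cexp_phasor (k - m)).continuousOn).1).const_mul _
  have hnorm : ∀ m t, ‖F m t‖ = ‖phasor T f m‖ * ‖a t‖ := fun m t => by
    simp only [F, norm_mul, norm_cexp_phasor, mul_one]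
  have hsum : Summable fun m => ∫ t in Set.Ioc 0 T, ‖F m t‖ := by
    simp only [hnorm, integral_const_mul]
    exact hs.mul_right _
  have h := (hasSum_integral_of_summable_integral_norm hint hsum).mul_left (1 / (T : ℂ))
  have h1 : ∀ m, 1 / (T : ℂ) * ∫ t in Set.Ioc 0 T, F m t =
      phasor T a (k - m) * phasor T f m := fun m => by
    simp only [F, integral_const_mul, phasor, intervalIntegral.integral_of_le hT.le]
    ring
  have h2 : ∀ t, ∑' m, F m t =
      a t * f t * Complex.exp (-(Complex.I * (2 * Real.pi / T) * k * t)) := by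
    intro t
    refine HasSum.tsum_eq ?_
    have h3 := (hasSum_phasor_mul_exp hT hf hper hs t).mul_left
      (a t * Complex.exp (-(Complex.I * (2 * Real.pi / T) * k * t)))
    have heq : (fun m => F m t) = fun m =>
        a t * Complex.exp (-(Complex.I * (2 * Real.pi / T) * k * t)) *
          (phasor T f m * Complex.exp (Complex.I * (2 * Real.pi / T) * m * t)) := by
      funext m
      have h4 : Complex.exp (-(Complex.I * (2 * Real.pi / T) * (k - m : ℤ) * t)) =
          Complex.exp (-(Complex.I * (2 * Real.pi / T) * k * t)) *
            Complex.exp (Complex.I * (2 * Real.pi / T) * m * t) := by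
        rw [← Complex.exp_add]
        congr 1
        push_cast
        ring
      simp only [F, h4]
      ring
    rw [heq]
    have h5 : a t * f t * Complex.exp (-(Complex.I * (2 * Real.pi / T) * k * t)) =
        a t * Complex.exp (-(Complex.I * (2 * Real.pi / T) * k * t)) * f t := by ring
    rwa [h5]
  simp only [h1, h2] at h
  rwa [phasor, intervalIntegral.integral_of_le hT.le]

end Phasor

/-! ### Infinite matrices on `ℓ²` -/

section Schur

variable {ι : Type*}

theorem memℓp_two_iff {x : ι → ℂ} :
    Memℓp x 2 ↔ Summable fun q => ‖x q‖ ^ 2 := by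
  rw [memℓp_gen_iff (by norm_num)]
  norm_num

theorem summable_mul_of_sq {a b : ι → ℝ} (ha : Summable fun q => a q ^ 2)
    (hb : Summable fun q => b q ^ 2) : Summable fun q => a q * b q := by
  refine Summable.of_norm_bounded (g := fun q => (a q ^ 2 + b q ^ 2) / 2)
    ((ha.add hb).div_const 2) fun q => ?_
  rw [norm_mul, Real.norm_eq_abs, Real.norm_eq_abs, ← sq_abs (a q), ← sq_abs (b q)]
  linarith [two_mul_le_add_sq |a q| |b q|]

/-- The hypotheses of the Schur test for the nonnegative kernel `K`. -/
structure SchurBound (K : ι → ι → ℝ) (C : ℝ) : Prop where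
  pos : 0 < C
  nonneg : ∀ p q, 0 ≤ K p q
  summable_row : ∀ p, Summable fun q => K p q
  row_le : ∀ p, ∑' q, K p q ≤ C
  summable_col : ∀ q, Summable fun p => K p q
  col_le : ∀ q, ∑' p, K p q ≤ C

namespace SchurBound

variable {K : ι → ι → ℝ} {C : ℝ} (h : SchurBound K C) {x : ι → ℝ}
  (hx : Summable fun q => x q ^ 2)
include h hx

theorem summable_mul_sq (p : ι) : Summable fun q => K p q * x q ^ 2 := by
  refine Summable.of_nonneg_of_le (fun q => mul_nonneg (h.nonneg p q) (sq_nonneg _)) (fun q => ?_)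
    (hx.mul_left C)
  refine mul_le_mul_of_nonneg_right ?_ (sq_nonneg _)
  exact ((h.summable_row p).le_tsum q fun r _ => h.nonneg p r).trans (h.row_le p)

theorem summable_mul (p : ι) : Summable fun q => K p q * x q := by
  refine Summable.of_norm_bounded (g := fun q => (K p q + K p q * x q ^ 2) / 2)
    (((h.summable_row p).add (h.summable_mul_sq hx p)).div_const 2) fun q => ?_
  rw [norm_mul, Real.norm_of_nonneg (h.nonneg p q), Real.norm_eq_abs, ← sq_abs (x q)]
  have := mul_nonneg (h.nonneg p q) (sq_nonneg (|x q| - 1))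
  nlinarith

theorem sq_tsum_le (p : ι) : (∑' q, K p q * x q) ^ 2 ≤ C * ∑' q, K p q * x q ^ 2 := by
  set S := ∑' q, K p q * x q with hS
  have h0 := (h.summable_row p).hasSum
  have h1 := (h.summable_mul hx p).hasSum
  have h2 := (h.summable_mul_sq hx p).hasSum
  have h3 := (h2.sub (h1.mul_left (2 * (S / C)))).add (h0.mul_left ((S / C) ^ 2))
  -- Cauchy–Schwarz by expanding `∑ K (x - S/C)² ≥ 0`; the shift `S/C` is optimal when the row sum
  -- equals its bound `C`.
  have h4 : 0 ≤ (∑' q, K p q * x q ^ 2) - 2 * (S / C) * S + (S / C) ^ 2 * ∑' q, K p q := by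
    refine h3.nonneg fun q => ?_
    have := mul_nonneg (h.nonneg p q) (sq_nonneg (x q - S / C))
    nlinarith
  have h5 : (S / C) ^ 2 * ∑' q, K p q ≤ (S / C) ^ 2 * C :=
    mul_le_mul_of_nonneg_left (h.row_le p) (sq_nonneg _)
  have h6 : (S / C) ^ 2 * C = S ^ 2 / C := by
    have := h.pos.ne'
    field_simp
  have h7 : 2 * (S / C) * S = 2 * (S ^ 2 / C) := by ring
  have h8 : S ^ 2 / C ≤ ∑' q, K p q * x q ^ 2 := by linarith
  rw [div_le_iff₀ h.pos] at h8
  linarith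

theorem summable_prod_mul_sq : Summable fun z : ι × ι => K z.2 z.1 * x z.1 ^ 2 := by
  refine (summable_prod_of_nonneg (f := fun z : ι × ι => K z.2 z.1 * x z.1 ^ 2)
    fun z => mul_nonneg (h.nonneg z.2 z.1) (sq_nonneg (x z.1))).2
      ⟨fun q => (h.summable_col q).mul_right (x q ^ 2), ?_⟩
  simp only [tsum_mul_right]
  refine Summable.of_nonneg_of_le (fun q => mul_nonneg (tsum_nonneg fun p => h.nonneg _ _)
    (sq_nonneg _)) (fun q => ?_) (hx.mul_left C)
  exact mul_le_mul_of_nonneg_right (h.col_le q) (sq_nonneg _)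

theorem summable_prod_mul_sq' : Summable fun z : ι × ι => K z.1 z.2 * x z.2 ^ 2 :=
  (Equiv.prodComm ι ι).summable_iff.1 (h.summable_prod_mul_sq hx)

theorem summable_sq : Summable fun p => (∑' q, K p q * x q) ^ 2 := by
  have hrow : Summable fun p => ∑' q, K p q * x q ^ 2 := (h.summable_prod_mul_sq' hx).prod
  exact Summable.of_nonneg_of_le (fun p => sq_nonneg _) (h.sq_tsum_le hx) (hrow.mul_left C)

/-- The Schur test: Cauchy–Schwarz in each row costs one factor `C` from the row sums; exchanging
the summations costs another from the column sums. -/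
theorem tsum_sq_le : ∑' p, (∑' q, K p q * x q) ^ 2 ≤ C ^ 2 * ∑' q, x q ^ 2 := by
  have hs := h.summable_prod_mul_sq hx
  have hrow : Summable fun p => ∑' q, K p q * x q ^ 2 := (h.summable_prod_mul_sq' hx).prod
  have hcol : Summable fun q => ∑' p, K p q * x q ^ 2 := hs.prod
  calc ∑' p, (∑' q, K p q * x q) ^ 2 ≤ ∑' p, C * ∑' q, K p q * x q ^ 2 :=
        (h.summable_sq hx).tsum_le_tsum (h.sq_tsum_le hx) (hrow.mul_left C)
    _ = C * ∑' q, ∑' p, K p q * x q ^ 2 := by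
        rw [tsum_mul_left, Summable.tsum_comm (f := fun q p => K p q * x q ^ 2) hs]
    _ ≤ C * ∑' q, C * x q ^ 2 := by
        refine mul_le_mul_of_nonneg_left (hcol.tsum_le_tsum (fun q => ?_) (hx.mul_left C))
          h.pos.le
        rw [tsum_mul_right]
        exact mul_le_mul_of_nonneg_right (h.col_le q) (sq_nonneg _)
    _ = C ^ 2 * ∑' q, x q ^ 2 := by
        rw [tsum_mul_left]
        ring

end SchurBound

theorem summable_triple_of_schur {B : ι → ι → ℂ} {C : ℝ} (hB : SchurBound (fun p q => ‖B p q‖) C)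
    {a x : ι → ℂ} (ha : Memℓp a 2) (hx : Memℓp x 2) :
    Summable fun z : ι × ι => a z.1 * B z.1 z.2 * x z.2 := by
  rw [memℓp_two_iff] at ha hx
  refine Summable.of_norm ?_
  rw [summable_prod_of_nonneg fun z => norm_nonneg _]
  simp only [norm_mul, mul_assoc]
  refine ⟨fun q => (hB.summable_mul hx q).mul_left _, ?_⟩
  simp only [tsum_mul_left]
  exact summable_mul_of_sq ha (hB.summable_sq hx)

/-- Serves kernels such as `(q - r) w_{q-r}`, whose rows are only square summable and to which the
Schur test does not apply. The price is that the row vector `a` must be in `ℓ¹`. -/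
theorem summable_triple_of_row {B : ι → ι → ℂ} {D : ℝ}
    (hB : ∀ q, Summable fun r => ‖B q r‖ ^ 2) (hD : ∀ q, ∑' r, ‖B q r‖ ^ 2 ≤ D)
    {a x : ι → ℂ} (ha : Summable fun q => ‖a q‖) (hx : Memℓp x 2) :
    Summable fun z : ι × ι => a z.1 * B z.1 z.2 * x z.2 := by
  rw [memℓp_two_iff] at hx
  refine Summable.of_norm ?_
  rw [summable_prod_of_nonneg fun z => norm_nonneg _]
  simp only [norm_mul, mul_assoc]
  have hrow : ∀ q, Summable fun r => ‖B q r‖ * ‖x r‖ := fun q => summable_mul_of_sq (hB q) hx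
  refine ⟨fun q => (hrow q).mul_left _, ?_⟩
  simp only [tsum_mul_left]
  refine Summable.of_nonneg_of_le
    (fun q => mul_nonneg (norm_nonneg _) (tsum_nonneg fun r => by positivity)) (fun q => ?_)
    (ha.mul_right ((D + ∑' r, ‖x r‖ ^ 2) / 2))
  refine mul_le_mul_of_nonneg_left ?_ (norm_nonneg _)
  calc ∑' r, ‖B q r‖ * ‖x r‖ ≤ ∑' r, (‖B q r‖ ^ 2 + ‖x r‖ ^ 2) / 2 :=
        (hrow q).tsum_le_tsum (fun r => by linarith [two_mul_le_add_sq ‖B q r‖ ‖x r‖])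
          (((hB q).add hx).div_const 2)
    _ = (∑' r, ‖B q r‖ ^ 2 + ∑' r, ‖x r‖ ^ 2) / 2 := by
        rw [tsum_div_const, (hB q).tsum_add hx]
    _ ≤ _ := by linarith [hD q]

/-- Fubini for a row vector, a matrix and a column vector. -/
theorem exists_hasSum_triple {a x y c : ι → ℂ} {B : ι → ι → ℂ}
    (h : Summable fun z : ι × ι => a z.1 * B z.1 z.2 * x z.2)
    (hy : ∀ q, HasSum (fun r => B q r * x r) (y q))
    (hc : ∀ r, HasSum (fun q => a q * B q r) (c r)) :
    ∃ S, HasSum (fun q => a q * y q) S ∧ HasSum (fun r => c r * x r) S := by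
  refine ⟨_, h.hasSum.prod_fiberwise fun q => ?_,
    ((Equiv.prodComm ι ι).hasSum_iff.2 h.hasSum).prod_fiberwise fun r => ?_⟩
  · simpa only [mul_assoc] using (hy q).mul_left (a q)
  · exact (hc r).mul_right (x r)

end Schur

/-! ### Bounded operators from Toeplitz matrices with summable coefficients -/

section Toeplitz

variable {n : ℕ}

theorem exists_isMatrixOf {M : Matrix (Fin n × ℤ) (Fin n × ℤ) ℂ} {C : ℝ}
    (h : SchurBound (fun p q => ‖M p q‖) C) :
    ∃ B : EllTwo n →L[ℂ] EllTwo n, IsMatrixOf M B := by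
  have hsq : ∀ x : EllTwo n, Summable fun q => ‖x q‖ ^ 2 := fun x => memℓp_two_iff.1 x.2
  have hnorm : ∀ x : EllTwo n, ∀ p, Summable fun q => ‖M p q * x q‖ := fun x p => by
    simpa only [norm_mul] using h.summable_mul (hsq x) p
  have hsum : ∀ x : EllTwo n, ∀ p, Summable fun q => M p q * x q :=
    fun x p => (hnorm x p).of_norm
  have hle : ∀ x : EllTwo n, ∀ p, ‖∑' q, M p q * x q‖ ^ 2 ≤ (∑' q, ‖M p q‖ * ‖x q‖) ^ 2 :=
    fun x p => by
      refine pow_le_pow_left₀ (norm_nonneg _) ?_ 2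
      simpa only [norm_mul] using norm_tsum_le_tsum_norm (hnorm x p)
  have hsummable : ∀ x : EllTwo n, Summable fun p => ‖∑' q, M p q * x q‖ ^ 2 := fun x =>
    Summable.of_nonneg_of_le (fun p => sq_nonneg _) (hle x) (h.summable_sq (hsq x))
  let L : EllTwo n →ₗ[ℂ] EllTwo n :=
    { toFun := fun x => ⟨fun p => ∑' q, M p q * x q, memℓp_two_iff.2 (hsummable x)⟩
      map_add' := fun x y => by
        ext p
        simp only [lp.coeFn_add, Pi.add_apply, mul_add]
        exact (hsum x p).tsum_add (hsum y p)
      map_smul' := fun c x => by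
        ext p
        simp only [lp.coeFn_smul, Pi.smul_apply, smul_eq_mul, RingHom.id_apply, mul_left_comm,
          tsum_mul_left] }
  have hnsq : ∀ x : EllTwo n, ‖x‖ ^ 2 = ∑' q, ‖x q‖ ^ 2 := fun x => by
    have := lp.norm_rpow_eq_tsum (p := 2) (by norm_num) x
    simpa using this
  refine ⟨L.mkContinuous C fun x => ?_, fun x p => (hsum x p).hasSum⟩
  refine le_of_sq_le_sq ?_ (mul_nonneg h.pos.le (norm_nonneg x))
  rw [mul_pow, hnsq, hnsq]
  exact ((hsummable x).tsum_le_tsum (hle x) (h.summable_sq (hsq x))).trans (h.tsum_sq_le (hsq x))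

theorem hasSum_fin_prod {E : Type*} [AddCommMonoid E] [TopologicalSpace E] [ContinuousAdd E]
    {f : Fin n × ℤ → E} {s : Fin n → E} (h : ∀ j, HasSum (fun l => f (j, l)) (s j)) :
    HasSum f (∑ j, s j) := by
  have h1 : ∀ j, HasSum (fun z : Fin n × ℤ => if z.1 = j then f z else 0) (s j) := by
    intro j
    rw [← Function.Injective.hasSum_iff (Prod.mk_right_injective j)]
    · simpa [Function.comp_def] using h j
    · rintro ⟨i, l⟩ hz
      rw [if_neg]
      rintro rfl
      exact hz ⟨l, rfl⟩
  simpa using hasSum_sum fun j (_ : j ∈ Finset.univ) => h1 j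

/-- The block Toeplitz matrix with symbol coefficients `w`. -/
def toeplitz (w : Fin n → Fin n → ℤ → ℂ) : Matrix (Fin n × ℤ) (Fin n × ℤ) ℂ :=
  Matrix.of fun p q => w p.1 q.1 (p.2 - q.2)

variable {w : Fin n → Fin n → ℤ → ℂ}

theorem hasSum_toeplitz_row {f : ℂ → ℝ} (hw : ∀ i j, Summable fun l => f (w i j l))
    (p : Fin n × ℤ) :
    HasSum (fun q => f (toeplitz w p q)) (∑ j, ∑' l, f (w p.1 j l)) :=
  hasSum_fin_prod fun j => by
    have h := (Equiv.subLeft p.2).hasSum_iff.2 (hw p.1 j).hasSum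
    exact h

theorem hasSum_toeplitz_col {f : ℂ → ℝ} (hw : ∀ i j, Summable fun l => f (w i j l))
    (q : Fin n × ℤ) :
    HasSum (fun p => f (toeplitz w p q)) (∑ i, ∑' l, f (w i q.1 l)) :=
  hasSum_fin_prod fun i => by
    have h := (Equiv.subRight q.2).hasSum_iff.2 (hw i q.1).hasSum
    exact h

theorem toeplitz_row_le {f : ℂ → ℝ} (hf : ∀ z, 0 ≤ f z) (i : Fin n) :
    ∑ j, ∑' l, f (w i j l) ≤ ∑ i, ∑ j, ∑' l, f (w i j l) :=
  Finset.single_le_sum (f := fun i => ∑ j, ∑' l, f (w i j l))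
    (fun _ _ => Finset.sum_nonneg fun _ _ => tsum_nonneg fun _ => hf _) (Finset.mem_univ i)

theorem toeplitz_col_le {f : ℂ → ℝ} (hf : ∀ z, 0 ≤ f z) (j : Fin n) :
    ∑ i, ∑' l, f (w i j l) ≤ ∑ i, ∑ j, ∑' l, f (w i j l) :=
  Finset.sum_le_sum fun i _ => Finset.single_le_sum (f := fun j => ∑' l, f (w i j l))
    (fun _ _ => tsum_nonneg fun _ => hf _) (Finset.mem_univ j)

theorem schurBound_toeplitz (hw : ∀ i j, Summable fun l => ‖w i j l‖) :
    SchurBound (fun p q => ‖toeplitz w p q‖) (1 + ∑ i, ∑ j, ∑' l, ‖w i j l‖) where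
  pos := add_pos_of_pos_of_nonneg one_pos
    (Finset.sum_nonneg fun _ _ => Finset.sum_nonneg fun _ _ => tsum_nonneg fun _ => norm_nonneg _)
  nonneg _ _ := norm_nonneg _
  summable_row p := (hasSum_toeplitz_row hw p).summable
  row_le p := by
    rw [(hasSum_toeplitz_row hw p).tsum_eq]
    linarith [toeplitz_row_le (w := w) norm_nonneg p.1]
  summable_col q := (hasSum_toeplitz_col hw q).summable
  col_le q := by
    rw [(hasSum_toeplitz_col hw q).tsum_eq]
    linarith [toeplitz_col_le (w := w) norm_nonneg q.1]

theorem memℓp_toeplitz_row (hw : ∀ i j, Summable fun l => ‖w i j l‖ ^ 2) (p : Fin n × ℤ) :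
    Memℓp (fun q => toeplitz w p q) 2 :=
  memℓp_two_iff.2 (hasSum_toeplitz_row (f := fun z => ‖z‖ ^ 2) hw p).summable

theorem summable_sq_of_summable_norm {ι : Type*} {f : ι → ℂ} (h : Summable fun l => ‖f l‖) :
    Summable fun l => ‖f l‖ ^ 2 := by
  have h1 : Memℓp f 1 := memℓp_gen (by simpa using h)
  exact memℓp_two_iff.1 (h1.of_exponent_ge (by norm_num))

end Toeplitz

/-! ### The harmonic similarity -/

section Similarity

variable {n : ℕ}

/-- Matrix identities pass to the operators through associativity `(VW)x = V(Wx)`, a Fubini exchange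
justified by the Schur bound. -/
theorem exists_inverse_toeplitz {v w : Fin n → Fin n → ℤ → ℂ}
    (hv : ∀ i j, Summable fun l => ‖v i j l‖) (hw : ∀ i j, Summable fun l => ‖w i j l‖)
    (hvw : ∀ p r, HasSum (fun q => toeplitz v p q * toeplitz w q r) (if p = r then 1 else 0))
    (hwv : ∀ p r, HasSum (fun q => toeplitz w p q * toeplitz v q r) (if p = r then 1 else 0)) :
    ∃ 𝒲 : EllTwo n ≃L[ℂ] EllTwo n,
      IsMatrixOf (toeplitz w) (𝒲 : EllTwo n →L[ℂ] EllTwo n) ∧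
      IsMatrixOf (toeplitz v) (𝒲.symm : EllTwo n →L[ℂ] EllTwo n) := by
  have key : ∀ {a b : Fin n → Fin n → ℤ → ℂ}, (∀ i j, Summable fun l => ‖a i j l‖) →
      (∀ i j, Summable fun l => ‖b i j l‖) →
      (∀ p r, HasSum (fun q => toeplitz a p q * toeplitz b q r) (if p = r then 1 else 0)) →
      ∀ {Ba Bb : EllTwo n →L[ℂ] EllTwo n}, IsMatrixOf (toeplitz a) Ba →
      IsMatrixOf (toeplitz b) Bb → ∀ x, Ba (Bb x) = x := by
    intro a b ha hb hab Ba Bb hBa hBb x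
    ext p
    have h := summable_triple_of_schur (schurBound_toeplitz hb)
      (memℓp_toeplitz_row (fun i j => summable_sq_of_summable_norm (ha i j)) p) x.2
    obtain ⟨S, h1, h2⟩ := exists_hasSum_triple h (hBb x) (hab p)
    rw [(hBa (Bb x) p).unique h1]
    refine h2.unique ?_
    have h3 := hasSum_ite_eq p (x p)
    refine (funext fun r => ?_ : (fun r => (if p = r then (1 : ℂ) else 0) * x r) =
      fun r => if r = p then x p else 0) ▸ h3
    by_cases hr : r = p
    · simp [hr]
    · simp [hr, Ne.symm hr]
  obtain ⟨Bw, hBw⟩ := exists_isMatrixOf (schurBound_toeplitz hw)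
  obtain ⟨Bv, hBv⟩ := exists_isMatrixOf (schurBound_toeplitz hv)
  exact ⟨.equivOfInverse Bw Bv (key hv hw hvw hBv hBw) (key hw hv hwv hBw hBv), hBw, hBv⟩

/-- The diagonal operator with entries `c k` at the frequency `k`. -/
def frequencyDiagonal (n : ℕ) (c : ℂ) : Matrix (Fin n × ℤ) (Fin n × ℤ) ℂ :=
  Matrix.diagonal fun p => c * p.2

theorem hasSum_frequencyDiagonal (c : ℂ) (x : EllTwo n) (p : Fin n × ℤ) :
    HasSum (fun q => frequencyDiagonal n c p q * x q) (c * p.2 * x p) := by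
  have h := hasSum_single (f := fun q => frequencyDiagonal n c p q * x q) p fun q hq => by
    simp [frequencyDiagonal, Matrix.diagonal_apply_ne' _ hq]
  simpa [frequencyDiagonal] using h

/-- Multiplication of a row of a Toeplitz matrix by the frequency. -/
theorem memℓp_toeplitz_row_mul {b : Fin n → Fin n → ℤ → ℂ}
    (hb : ∀ i j, Summable fun l => ‖b i j l‖)
    (hb' : ∀ i j, Summable fun l : ℤ => ‖(l : ℂ) * b i j l‖ ^ 2) (p : Fin n × ℤ) :
    Memℓp (fun q : Fin n × ℤ => toeplitz b p q * (q.2 : ℂ)) 2 := by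
  have h1 := (memℓp_toeplitz_row
    (fun i j => summable_sq_of_summable_norm (hb i j)) p).const_smul (p.2 : ℂ)
  have h2 := h1.sub (memℓp_toeplitz_row hb' p)
  -- The column frequency is split as `q = p - (p - q)`: the row frequency is constant along the
  -- row, and the difference is absorbed by the decay of `b`.
  have h3 : (fun q : Fin n × ℤ => toeplitz b p q * (q.2 : ℂ)) =
      ((p.2 : ℂ) • fun q => toeplitz b p q) -
        fun q => toeplitz (fun i j l => (l : ℂ) * b i j l) p q := by
    funext q
    simp only [toeplitz, Matrix.of_apply, Pi.sub_apply, Pi.smul_apply, smul_eq_mul]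
    push_cast
    ring
  rwa [h3]

theorem kronecker_one_eq_toeplitz (Λ : Matrix (Fin n) (Fin n) ℂ) :
    Λ ⊗ₖ (1 : Matrix ℤ ℤ ℂ) = toeplitz fun i j k => if k = 0 then Λ i j else 0 := by
  ext p q
  simp [toeplitz, Matrix.one_apply, sub_eq_zero]

theorem exists_schurBound_kronecker_one (Λ : Matrix (Fin n) (Fin n) ℂ) :
    ∃ C, SchurBound (fun p q => ‖(Λ ⊗ₖ (1 : Matrix ℤ ℤ ℂ)) p q‖) C := by
  rw [kronecker_one_eq_toeplitz]
  refine ⟨_, schurBound_toeplitz fun i j => summable_of_ne_finset_zero (s := {0}) fun k hk => ?_⟩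
  have : k ≠ 0 := by simpa using hk
  simp [this]

theorem hasSum_toeplitz_mul_kronecker_one (w : Fin n → Fin n → ℤ → ℂ)
    (Λ : Matrix (Fin n) (Fin n) ℂ) (p r : Fin n × ℤ) :
    HasSum (fun q => toeplitz w p q * (Λ ⊗ₖ (1 : Matrix ℤ ℤ ℂ)) q r)
      (∑ j, w p.1 j (p.2 - r.2) * Λ j r.1) := by
  refine hasSum_fin_prod fun j => ?_
  have h := hasSum_single
    (f := fun l => toeplitz w p (j, l) * (Λ ⊗ₖ (1 : Matrix ℤ ℤ ℂ)) (j, l) r) r.2 fun l hl => by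
      simp [hl]
  simpa [toeplitz] using h

/-! ### The intertwining relation and equality of domains -/

section Intertwining

variable {a v w : Fin n → Fin n → ℤ → ℂ} {Λ : Matrix (Fin n) (Fin n) ℂ} {c : ℂ}
  {BL : EllTwo n →L[ℂ] EllTwo n} {𝒲 : EllTwo n ≃L[ℂ] EllTwo n}

/-- The relation `(𝒜 - 𝒩)𝒲x = 𝒲(Λ - 𝒩)x` holds entrywise for every `x` in `ℓ²`, inside the domains
or not: rows of `𝒲` multiplied by the frequency are still in `ℓ²`, so all sums converge. In `haw`
the term `c (p - r) w` is an entry of the commutator `𝒩𝒲 - 𝒲𝒩`. -/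
theorem exists_hasSum_intertwining
    (ha : ∀ i j, Summable fun l => ‖a i j l‖ ^ 2)
    (hw : ∀ i j, Summable fun l => ‖w i j l‖)
    (hw' : ∀ i j, Summable fun l : ℤ => ‖(l : ℂ) * w i j l‖ ^ 2)
    (haw : ∀ p r, HasSum (fun q => toeplitz a p q * toeplitz w q r)
      (c * (p.2 - r.2 : ℤ) * toeplitz w p r + ∑ j, w p.1 j (p.2 - r.2) * Λ j r.1))
    (hBL : IsMatrixOf (Λ ⊗ₖ (1 : Matrix ℤ ℤ ℂ)) BL)
    (h𝒲 : ∀ x p, HasSum (fun q => toeplitz w p q * x q) (𝒲 x p))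
    (x : EllTwo n) (p : Fin n × ℤ) :
    ∃ S, HasSum (fun q => (toeplitz a - frequencyDiagonal n c) p q * 𝒲 x q) S ∧
      HasSum (fun r => toeplitz w p r * (BL x r - c * r.2 * x r)) S := by
  obtain ⟨C, hLS⟩ := exists_schurBound_kronecker_one Λ
  have hWrow := memℓp_toeplitz_row fun i j => summable_sq_of_summable_norm (hw i j)
  obtain ⟨S₁, h1, h1'⟩ := exists_hasSum_triple
    (summable_triple_of_schur (schurBound_toeplitz hw) (memℓp_toeplitz_row ha p) x.2) (h𝒲 x)
    (haw p)
  obtain ⟨S₂, h2, h2'⟩ := exists_hasSum_triple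
    (summable_triple_of_schur hLS (hWrow p) x.2) (hBL x)
    (hasSum_toeplitz_mul_kronecker_one w Λ p)
  obtain ⟨S₃, h3⟩ : Summable fun r => toeplitz w p r * (r.2 : ℂ) * x r := by
    refine Summable.of_norm ?_
    simp only [norm_mul _ (x _)]
    exact summable_mul_of_sq (memℓp_two_iff.1 (memℓp_toeplitz_row_mul hw hw' p))
      (memℓp_two_iff.1 x.2)
  have h5 := (((h𝒲 x p).mul_left (c * p.2)).sub (h3.mul_left c)).add h2'
  have h6 : (fun r : Fin n × ℤ => c * p.2 * (toeplitz w p r * x r) -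
      c * (toeplitz w p r * (r.2 : ℂ) * x r) +
        (∑ j, w p.1 j (p.2 - r.2) * Λ j r.1) * x r) = fun r =>
      (c * (p.2 - r.2 : ℤ) * toeplitz w p r + ∑ j, w p.1 j (p.2 - r.2) * Λ j r.1) * x r := by
    funext r
    push_cast
    ring
  rw [h6] at h5
  refine ⟨S₁ - c * p.2 * 𝒲 x p, ?_, ?_⟩
  · simpa only [Matrix.sub_apply, sub_mul] using h1.sub (hasSum_frequencyDiagonal c (𝒲 x) p)
  · have h8 := h2.sub (h3.mul_left c)
    have h9 : (fun r : Fin n × ℤ => toeplitz w p r * BL x r -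
        c * (toeplitz w p r * (r.2 : ℂ) * x r)) =
          fun r => toeplitz w p r * (BL x r - c * r.2 * x r) := by
      funext r
      ring
    rw [h9] at h8
    have h10 : S₁ - c * p.2 * 𝒲 x p = S₂ - c * S₃ := by
      rw [h1'.unique h5]
      ring
    rwa [h10]

/-- Since `(Λ - 𝒩)x` is not known to lie in `ℓ²`, the bounded inverse cannot simply be applied to
`𝒲(Λ - 𝒩)x`. The exchange of sums is instead justified directly by writing `-r = (q - r) - q`: the
difference goes to `w`, and `q` goes to `v`. -/
theorem eq_symm_of_hasSum_intertwining
    (hv : ∀ i j, Summable fun l => ‖v i j l‖) (hw : ∀ i j, Summable fun l => ‖w i j l‖)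
    (hv' : ∀ i j, Summable fun l : ℤ => ‖(l : ℂ) * v i j l‖ ^ 2)
    (hw' : ∀ i j, Summable fun l : ℤ => ‖(l : ℂ) * w i j l‖ ^ 2)
    (hvw : ∀ p r, HasSum (fun q => toeplitz v p q * toeplitz w q r) (if p = r then 1 else 0))
    (h𝒱 : ∀ x p, HasSum (fun q => toeplitz v p q * x q) (𝒲.symm x p))
    {x y : EllTwo n}
    (hy : ∀ p, HasSum (fun r => toeplitz w p r * (BL x r - c * r.2 * x r)) (y p))
    (p : Fin n × ℤ) : BL x p - c * p.2 * x p = 𝒲.symm y p := by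
  let w' : Fin n → Fin n → ℤ → ℂ := fun i j l => (l : ℂ) * w i j l
  have hVrow := memℓp_toeplitz_row fun i j => summable_sq_of_summable_norm (hv i j)
  have s1 := summable_triple_of_schur (schurBound_toeplitz hw) (hVrow p) (BL x).2
  have s2 := summable_triple_of_schur (schurBound_toeplitz hw)
    (memℓp_toeplitz_row_mul hv hv' p) x.2
  have s3 := summable_triple_of_row (B := toeplitz w')
    (fun q => memℓp_two_iff.1 (memℓp_toeplitz_row hw' q))
    (fun q => ((hasSum_toeplitz_row (f := fun z => ‖z‖ ^ 2) hw' q).tsum_eq.le.trans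
      (toeplitz_row_le (w := w') (f := fun z => ‖z‖ ^ 2) (fun z => sq_nonneg _) q.1)))
    (hasSum_toeplitz_row hv p).summable x.2
  have s : Summable fun z : (Fin n × ℤ) × (Fin n × ℤ) =>
      toeplitz v p z.1 * toeplitz w z.1 z.2 * (BL x z.2 - c * z.2.2 * x z.2) := by
    refine ((s1.add (s3.mul_left c)).sub (s2.mul_left c)).congr fun z => ?_
    simp only [w', toeplitz, Matrix.of_apply]
    push_cast
    ring
  obtain ⟨S, h1, h2⟩ := exists_hasSum_triple (x := fun r => BL x r - c * r.2 * x r) s hy (hvw p)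
  rw [← h1.unique (h𝒱 y p)]
  have h3 : (fun r : Fin n × ℤ => (if p = r then (1 : ℂ) else 0) * (BL x r - c * r.2 * x r)) =
      fun r => if r = p then BL x p - c * p.2 * x p else 0 := by
    funext r
    by_cases hr : r = p
    · simp [hr]
    · simp [hr, Ne.symm hr]
  rw [h3] at h2
  exact (hasSum_ite_eq p _).unique h2

/-- The harmonic operators of `A` and of the constant matrix `Λ` are similar. -/
theorem conjugate_toeplitz_eq
    (ha : ∀ i j, Summable fun l => ‖a i j l‖ ^ 2)
    (hv : ∀ i j, Summable fun l => ‖v i j l‖) (hw : ∀ i j, Summable fun l => ‖w i j l‖)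
    (hv' : ∀ i j, Summable fun l : ℤ => ‖(l : ℂ) * v i j l‖ ^ 2)
    (hw' : ∀ i j, Summable fun l : ℤ => ‖(l : ℂ) * w i j l‖ ^ 2)
    (hvw : ∀ p r, HasSum (fun q => toeplitz v p q * toeplitz w q r) (if p = r then 1 else 0))
    (haw : ∀ p r, HasSum (fun q => toeplitz a p q * toeplitz w q r)
      (c * (p.2 - r.2 : ℤ) * toeplitz w p r + ∑ j, w p.1 j (p.2 - r.2) * Λ j r.1))
    (h𝒲 : ∀ x p, HasSum (fun q => toeplitz w p q * x q) (𝒲 x p))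
    (h𝒱 : ∀ x p, HasSum (fun q => toeplitz v p q * x q) (𝒲.symm x p)) :
    conjugate 𝒲 (matrixOperator (toeplitz a - frequencyDiagonal n c)) =
      matrixOperator (Λ ⊗ₖ (1 : Matrix ℤ ℤ ℂ) - frequencyDiagonal n c) := by
  obtain ⟨C, hLS⟩ := exists_schurBound_kronecker_one Λ
  obtain ⟨BL, hBL⟩ := exists_isMatrixOf hLS
  have hR : ∀ (x : EllTwo n) p,
      HasSum (fun q => (Λ ⊗ₖ (1 : Matrix ℤ ℤ ℂ) - frequencyDiagonal n c) p q * x q)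
        (BL x p - c * p.2 * x p) := by
    intro x p
    simpa only [Matrix.sub_apply, sub_mul] using (hBL x p).sub (hasSum_frequencyDiagonal c x p)
  have hforward := exists_hasSum_intertwining ha hw hw' haw hBL h𝒲
  refine LinearPMap.ext (Submodule.ext fun x => ⟨?_, ?_⟩) fun x h1 h2 => ?_
  -- If `(𝒜 - 𝒩)𝒲x = y` is in `ℓ²`, then `(Λ - 𝒩)x` is the `ℓ²` vector `𝒲⁻¹y`.
  · rintro ⟨y, hy⟩
    refine ⟨𝒲.symm y, fun p => ?_⟩
    rw [← eq_symm_of_hasSum_intertwining hv hw hv' hw' hvw h𝒱 (BL := BL) (c := c) (x := x)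
      (fun p => ?_) p]
    · exact hR x p
    · obtain ⟨S, h2, h3⟩ := hforward x p
      have h4 := (hy p).unique h2
      rwa [h4]
  -- Conversely, if `(Λ - 𝒩)x = y` is in `ℓ²`, then `(𝒜 - 𝒩)𝒲x = 𝒲y` by boundedness of `𝒲`.
  · rintro ⟨y, hy⟩
    refine ⟨𝒲 y, fun p => ?_⟩
    obtain ⟨S, h2, h3⟩ := hforward x p
    simp only [fun r => (hR x r).unique (hy r)] at h3
    rw [h3.unique (h𝒲 y p)] at h2
    exact h2
  · have hx := matrixOperator_hasSum _ ⟨x, h2⟩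
    have h1' : 𝒲 x ∈ (matrixOperator (toeplitz a - frequencyDiagonal n c)).domain := h1
    have h𝒲x := matrixOperator_hasSum _ ⟨𝒲 x, h1'⟩
    change 𝒲.symm (matrixOperator (toeplitz a - frequencyDiagonal n c) ⟨𝒲 x, h1'⟩) = _
    rw [ContinuousLinearEquiv.symm_apply_eq]
    ext p
    obtain ⟨S, h4, h5⟩ := hforward x p
    simp only [fun r => (hR x r).unique (hx r)] at h5
    rw [(h𝒲x p).unique h4]
    exact h5.unique (h𝒲 _ p)

end Intertwining

theorem harmonicN_eq (T : ℝ) :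
    harmonicN n T = frequencyDiagonal n (Complex.I * (2 * Real.pi / T)) := by
  ext p q
  by_cases h : p = q
  · simp [h, harmonicN, frequencyDiagonal]
  · rw [frequencyDiagonal, Matrix.diagonal_apply_ne _ h, harmonicN, Matrix.kroneckerMap_apply]
    by_cases h1 : p.1 = q.1
    · have h2 : p.2 ≠ q.2 := fun h2 => h (Prod.ext h1 h2)
      simp [h2]
    · simp [h1]

end Similarity

/-! ### Periodic Floquet factors -/

section Periodic

variable {n : ℕ} {T : ℝ}

theorem memLp_mul_continuous {a f : ℝ → ℂ} (ha : MemLp a 2 (volume.restrict (Set.Icc 0 T)))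
    (hf : Continuous f) : MemLp (fun t => a t * f t) 2 (volume.restrict (Set.Icc 0 T)) := by
  obtain ⟨C, hC⟩ := isCompact_Icc.exists_bound_of_continuousOn (hf.continuousOn (s := Set.Icc 0 T))
  have h : MemLp f ⊤ (volume.restrict (Set.Icc 0 T)) :=
    memLp_top_of_bound hf.aestronglyMeasurable C
      ((ae_restrict_iff' measurableSet_Icc).2 (.of_forall hC))
  exact h.mul ha

theorem intervalIntegrable_of_memLp_periodic (hT : 0 < T) {a : ℝ → ℂ}
    (hper : Function.Periodic a T) (ha : MemLp a 2 (volume.restrict (Set.Icc 0 T))) (b c : ℝ) :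
    IntervalIntegrable a volume b c := by
  refine hper.intervalIntegrable (t := 0) hT.ne' ?_ b c
  rw [zero_add, intervalIntegrable_iff_integrableOn_Icc_of_le hT.le]
  exact ha.integrable (by norm_num)

theorem periodic_entry {l m : Type*} {G : ℝ → Matrix l m ℂ} (h : Function.Periodic G T) (i : l)
    (j : m) : Function.Periodic (fun t => G t i j) T :=
  fun t => congrFun (congrFun (h t) i) j

theorem memLp_mul {A X : ℝ → Matrix (Fin n) (Fin n) ℂ}
    (hA : ∀ i j, MemLp (fun t => A t i j) 2 (volume.restrict (Set.Icc 0 T)))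
    (hX : ∀ i j, Continuous fun t => X t i j) (i j : Fin n) :
    MemLp (fun t => (A t * X t) i j) 2 (volume.restrict (Set.Icc 0 T)) := by
  simp only [Matrix.mul_apply]
  exact memLp_finsetSum _ fun k _ => memLp_mul_continuous (hA i k) (hX k j)

theorem memLp_mul' {A X : ℝ → Matrix (Fin n) (Fin n) ℂ}
    (hA : ∀ i j, MemLp (fun t => A t i j) 2 (volume.restrict (Set.Icc 0 T)))
    (hX : ∀ i j, Continuous fun t => X t i j) (i j : Fin n) :
    MemLp (fun t => (X t * A t) i j) 2 (volume.restrict (Set.Icc 0 T)) := by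
  simp only [Matrix.mul_apply, mul_comm (X _ _ _)]
  exact memLp_finsetSum _ fun k _ => memLp_mul_continuous (hA k j) (hX i k)

theorem IsPrimitive.summable_sq_mul_phasor (hT : 0 < T) {f g : ℝ → ℂ} (h : IsPrimitive f g)
    (hg : ∀ a b : ℝ, IntervalIntegrable g volume a b)
    (hg2 : MemLp g 2 (volume.restrict (Set.Icc 0 T))) (hper : f T = f 0) :
    Summable fun k : ℤ => ‖(k : ℂ) * phasor T f k‖ ^ 2 := by
  set c : ℂ := Complex.I * (2 * Real.pi / T) with hc
  have hc0 : c ≠ 0 := by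
    have hT' : (T : ℂ) ≠ 0 := Complex.ofReal_ne_zero.2 hT.ne'
    have hπ : (Real.pi : ℂ) ≠ 0 := Complex.ofReal_ne_zero.2 Real.pi_ne_zero
    simp [hc, hT', hπ]
  refine ((summable_sq_phasor hT hg2).mul_left (‖c⁻¹‖ ^ 2)).congr fun k => ?_
  rw [← mul_pow, ← norm_mul, h.phasor_deriv hT hg hper k, ← hc, mul_assoc,
    inv_mul_cancel_left₀ hc0]

/-- The convolution theorem in block form: two-sided Toeplitz matrices multiply like their symbols.
Only the right factor needs summable phasors, so `F` may be the coefficient matrix `A`. -/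
theorem hasSum_blockToeplitz_mul (hT : 0 < T) {F G : ℝ → Matrix (Fin n) (Fin n) ℂ}
    (hF : ∀ i j, IntervalIntegrable (fun t => F t i j) volume 0 T)
    (hG : ∀ i j, Continuous fun t => G t i j) (hper : Function.Periodic G T)
    (hs : ∀ i j, Summable fun k => ‖phasor T (fun t => G t i j) k‖) (p r : Fin n × ℤ) :
    HasSum (fun q => blockToeplitz T F p q * blockToeplitz T G q r)
      (phasor T (fun t => (F t * G t) p.1 r.1) (p.2 - r.2)) := by
  simp only [Matrix.mul_apply]
  rw [phasor_sum _ fun j _ => (hF p.1 j).mul_continuousOn (hG j r.1).continuousOn]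
  refine hasSum_fin_prod fun j => ?_
  have h := (Equiv.subRight r.2).hasSum_iff.2 (hasSum_phasor_mul hT (hF p.1 j) (hG j r.1)
    (periodic_entry hper j r.1) (hs j r.1) (p.2 - r.2))
  have he : ((fun m => phasor T (fun t => F t p.1 j) (p.2 - r.2 - m) *
      phasor T (fun t => G t j r.1) m) ∘ ⇑(Equiv.subRight r.2)) =
      fun l => blockToeplitz T F p (j, l) * blockToeplitz T G (j, l) r := by
    funext l
    simp [blockToeplitz]
  rwa [he] at h

theorem hasSum_blockToeplitz_mul_inverse (hT : 0 < T) {F G : ℝ → Matrix (Fin n) (Fin n) ℂ}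
    (hF : ∀ i j, Continuous fun t => F t i j)
    (hG : ∀ i j, Continuous fun t => G t i j) (hper : Function.Periodic G T)
    (hs : ∀ i j, Summable fun k => ‖phasor T (fun t => G t i j) k‖) (hFG : ∀ t, F t * G t = 1)
    (p r : Fin n × ℤ) :
    HasSum (fun q => blockToeplitz T F p q * blockToeplitz T G q r) (if p = r then 1 else 0) := by
  have h := hasSum_blockToeplitz_mul hT (fun i j => (hF i j).intervalIntegrable 0 T) hG hper hs p r
  simp only [hFG, phasor_const hT, sub_eq_zero, Matrix.one_apply] at h
  have he : (if p.2 = r.2 then if p.1 = r.1 then (1 : ℂ) else 0 else 0) =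
      if p = r then 1 else 0 := by
    simp only [Prod.ext_iff]
    split_ifs <;> simp_all
  rwa [he] at h

theorem blockToeplitz_eq (A : ℝ → Matrix (Fin n) (Fin n) ℂ) :
    blockToeplitz T A = toeplitz fun i j => phasor T fun t => A t i j :=
  rfl

theorem exists_harmonic_similarity (hT : 0 < T) {A W V : ℝ → Matrix (Fin n) (Fin n) ℂ}
    {Λ : Matrix (Fin n) (Fin n) ℂ} (hper : Function.Periodic A T)
    (hL2 : ∀ i j, MemLp (fun t => A t i j) 2 (volume.restrict (Set.Icc 0 T)))
    (hW : IsMatPrimitive W (fun t => A t * W t - W t * Λ))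
    (hV : IsMatPrimitive V (fun t => Λ * V t - V t * A t))
    (hWper : Function.Periodic W T) (hVper : Function.Periodic V T)
    (hVW : ∀ t, V t * W t = 1) :
    ∃ 𝒲 : EllTwo n ≃L[ℂ] EllTwo n,
      IsMatrixOf (blockToeplitz T W) (𝒲 : EllTwo n →L[ℂ] EllTwo n) ∧
      conjugate 𝒲 (matrixOperator (blockToeplitz T A - harmonicN n T)) =
        matrixOperator (Λ ⊗ₖ (1 : Matrix ℤ ℤ ℂ) - harmonicN n T) := by
  have hA : ∀ i j, ∀ a b : ℝ, IntervalIntegrable (fun t => A t i j) volume a b := fun i j =>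
    intervalIntegrable_of_memLp_periodic hT (periodic_entry hper i j) (hL2 i j)
  have hWc : ∀ i j, Continuous fun t => W t i j := fun i j => (hW i j).continuous
  have hVc : ∀ i j, Continuous fun t => V t i j := fun i j => (hV i j).continuous
  have hΛ : ∀ i j, MemLp (fun _ : ℝ => Λ i j) 2 (volume.restrict (Set.Icc 0 T)) :=
    fun i j => memLp_const _
  have hW2 : ∀ i j, MemLp (fun t => (A t * W t - W t * Λ) i j) 2
      (volume.restrict (Set.Icc 0 T)) := fun i j =>
    (memLp_mul hL2 hWc i j).sub (memLp_mul' (A := fun _ => Λ) hΛ hWc i j)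
  have hV2 : ∀ i j, MemLp (fun t => (Λ * V t - V t * A t) i j) 2
      (volume.restrict (Set.Icc 0 T)) := fun i j =>
    (memLp_mul (A := fun _ => Λ) hΛ hVc i j).sub (memLp_mul' hL2 hVc i j)
  have hWi : ∀ i j, ∀ a b : ℝ,
      IntervalIntegrable (fun t => (A t * W t - W t * Λ) i j) volume a b := fun i j =>
    intervalIntegrable_of_memLp_periodic hT
      (periodic_entry (fun t => by simp only [hper t, hWper t]) i j) (hW2 i j)
  have hVi : ∀ i j, ∀ a b : ℝ,
      IntervalIntegrable (fun t => (Λ * V t - V t * A t) i j) volume a b := fun i j =>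
    intervalIntegrable_of_memLp_periodic hT
      (periodic_entry (fun t => by simp only [hper t, hVper t]) i j) (hV2 i j)
  have hW0 : ∀ i j, W T i j = W 0 i j := fun i j => by
    have := periodic_entry hWper i j 0
    rwa [zero_add] at this
  have hV0 : ∀ i j, V T i j = V 0 i j := fun i j => by
    have := periodic_entry hVper i j 0
    rwa [zero_add] at this
  have hw := fun i j => (hW i j).summable_phasor hT (hWi i j) (hW2 i j) (hW0 i j)
  have hv := fun i j => (hV i j).summable_phasor hT (hVi i j) (hV2 i j) (hV0 i j)
  have hw' := fun i j => (hW i j).summable_sq_mul_phasor hT (hWi i j) (hW2 i j) (hW0 i j)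
  have hv' := fun i j => (hV i j).summable_sq_mul_phasor hT (hVi i j) (hV2 i j) (hV0 i j)
  have hvw := hasSum_blockToeplitz_mul_inverse hT hVc hWc hWper hw hVW
  have hwv := hasSum_blockToeplitz_mul_inverse hT hWc hVc hVper hv
    fun t => mul_eq_one_comm.1 (hVW t)
  simp only [blockToeplitz_eq, harmonicN_eq] at hvw hwv ⊢
  obtain ⟨𝒲, h𝒲, h𝒱⟩ := exists_inverse_toeplitz hv hw hvw hwv
  refine ⟨𝒲, h𝒲, ?_⟩
  refine conjugate_toeplitz_eq (fun i j => summable_sq_phasor hT (hL2 i j)) hv hw hv' hw' hvw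
    (fun p r => ?_) h𝒲 h𝒱
  have h := hasSum_blockToeplitz_mul hT (fun i j => hA i j 0 T) hWc hWper hw p r
  rw [blockToeplitz_eq, blockToeplitz_eq] at h
  -- `AW = Ẇ + WΛ`: the phasors of `Ẇ` are those of `W` times the frequency, which produces the
  -- commutator with `𝒩`.
  have hsplit : ∀ t, (A t * W t) p.1 r.1 =
      (A t * W t - W t * Λ) p.1 r.1 + ∑ j, W t p.1 j * Λ j r.1 := fun t => by
    rw [← Matrix.mul_apply, Matrix.sub_apply, sub_add_cancel]
  simp only [hsplit] at h
  have hji : ∀ j, IntervalIntegrable (fun t => W t p.1 j * Λ j r.1) volume 0 T := fun j =>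
    ((hWc p.1 j).mul continuous_const).intervalIntegrable 0 T
  rw [phasor_add (hWi p.1 r.1 0 T) (intervalIntegrable_fun_sum _ fun j _ => hji j),
    phasor_sum _ fun j _ => hji j, (hW p.1 r.1).phasor_deriv hT (hWi p.1 r.1)
      (hW0 p.1 r.1)] at h
  simp only [phasor_mul_const] at h
  exact h

end Periodic

/-! ### Reduction to constant coefficients, the inverse factor and its periodicity -/

theorem IsMatPrimitive.mulVec {l m : Type*} [Fintype m] {F F' : ℝ → Matrix l m ℂ}
    (hF : IsMatPrimitive F F') {x x' : ℝ → m → ℂ}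
    (hx : ∀ i, IsPrimitive (fun t => x t i) (fun t => x' t i)) (i : l) :
    IsPrimitive (fun t => (F t *ᵥ x t) i) (fun t => (F' t *ᵥ x t + F t *ᵥ x' t) i) := by
  simp only [Matrix.mulVec, dotProduct, Pi.add_apply]
  refine (IsPrimitive.sum Finset.univ fun k _ => (hF i k).mul (hx k)).congr fun t => ?_
  rw [Finset.sum_add_distrib]

/-- In `(Vx)' = (ΛV - VA)x + VAx` the terms with `A` cancel; the converse is the same computation
for `x = W(Vx)`. -/
theorem isSolution_iff_reduced {n : ℕ} {A W V : ℝ → Matrix (Fin n) (Fin n) ℂ}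
    {Λ : Matrix (Fin n) (Fin n) ℂ}
    (hW : IsMatPrimitive W (fun t => A t * W t - W t * Λ))
    (hV : IsMatPrimitive V (fun t => Λ * V t - V t * A t))
    (hVW : ∀ t, V t * W t = 1) (x : ℝ → Fin n → ℂ) :
    IsSolution A x ↔ IsSolution (fun _ => Λ) (fun t => V t *ᵥ x t) := by
  simp only [isSolution_iff]
  constructor
  · intro h i
    refine (hV.mulVec (x := x) (x' := fun t => A t *ᵥ x t) h i).congr fun t => ?_
    simp [Matrix.sub_mulVec]
  · intro h i
    have hx : ∀ t, W t *ᵥ (V t *ᵥ x t) = x t := fun t => by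
      rw [Matrix.mulVec_mulVec, mul_eq_one_comm.1 (hVW t), Matrix.one_mulVec]
    have h1 := hW.mulVec (x := fun t => V t *ᵥ x t) (x' := fun t => Λ *ᵥ (V t *ᵥ x t)) h i
    simp only [hx] at h1
    refine h1.congr fun t => ?_
    rw [Matrix.sub_mulVec, ← Matrix.mulVec_mulVec, ← Matrix.mulVec_mulVec, hx, sub_add_cancel]

/-- The inverse of the periodic Floquet factor. -/
theorem IsTransitionMatrix.exists_floquet_inverse {n : ℕ} {A Φ : ℝ → Matrix (Fin n) (Fin n) ℂ}
    (hA : ∀ i j, ∀ a b : ℝ, IntervalIntegrable (fun t => A t i j) volume a b)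
    (hΦ : IsTransitionMatrix A Φ) {Ψ Λ : Matrix (Fin n) (Fin n) ℂ} (hΨ : IsUnit Ψ.det)
    {W : ℝ → Matrix (Fin n) (Fin n) ℂ}
    (hW : ∀ t : ℝ, W t = Φ t * Ψ * NormedSpace.exp ((-(t : ℂ)) • Λ)) :
    ∃ V : ℝ → Matrix (Fin n) (Fin n) ℂ, IsMatPrimitive V (fun t => Λ * V t - V t * A t) ∧
      ∀ t, V t * W t = 1 := by
  obtain ⟨Z, hZ, hZ0, hZΦ⟩ := hΦ.exists_inverse hA
  refine ⟨fun t => NormedSpace.exp ((t : ℂ) • Λ) * Ψ⁻¹ * Z t, ?_, fun t => ?_⟩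
  · refine (((IsMatPrimitive.exp_smul Λ).mul (IsMatPrimitive.const Ψ⁻¹)).mul hZ).congr fun t => ?_
    noncomm_ring
  · rw [hW]
    calc _ = NormedSpace.exp ((t : ℂ) • Λ) * (Ψ⁻¹ * (Z t * Φ t) * Ψ) *
          NormedSpace.exp ((-(t : ℂ)) • Λ) := by simp only [Matrix.mul_assoc]
      _ = 1 := by
        rw [hZΦ, Matrix.mul_one, Matrix.nonsing_inv_mul _ hΨ, Matrix.mul_one,
          exp_smul_mul_exp_neg_smul]

/-- Over one period `Φ` gains the factor `Φ(T)`, which normalization moves across `Ψ` as `e^{TΛ}`,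
where it cancels the new factor `e^{-TΛ}`. -/
theorem IsTransitionMatrix.floquet_periodic {n : ℕ} {T : ℝ}
    {A Φ : ℝ → Matrix (Fin n) (Fin n) ℂ}
    (hA : ∀ i j, ∀ a b : ℝ, IntervalIntegrable (fun t => A t i j) volume a b)
    (hΦ : IsTransitionMatrix A Φ) (hper : Function.Periodic A T)
    {Ψ Λ : Matrix (Fin n) (Fin n) ℂ}
    (hΨ : Φ T * Ψ = Ψ * NormedSpace.exp ((T : ℂ) • Λ)) :
    Function.Periodic (fun t : ℝ => Φ t * Ψ * NormedSpace.exp ((-(t : ℂ)) • Λ)) T := by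
  intro t
  have h1 : -((t + T : ℝ) : ℂ) = -(T : ℂ) + -(t : ℂ) := by push_cast; ring
  change Φ (t + T) * Ψ * NormedSpace.exp ((-((t + T : ℝ) : ℂ)) • Λ) = _
  rw [h1, exp_add_smul, hΦ.add_period hA hper]
  calc _ = Φ t * (Φ T * Ψ) * NormedSpace.exp ((-(T : ℂ)) • Λ) *
        NormedSpace.exp ((-(t : ℂ)) • Λ) := by simp only [Matrix.mul_assoc]
    _ = Φ t * Ψ * (NormedSpace.exp ((T : ℂ) • Λ) * NormedSpace.exp ((-(T : ℂ)) • Λ)) *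
        NormedSpace.exp ((-(t : ℂ)) • Λ) := by rw [hΨ]; simp only [Matrix.mul_assoc]
    _ = _ := by rw [exp_smul_mul_exp_neg_smul, Matrix.mul_one]

end Floquet

theorem mainTheorem1 (n : ℕ) (T : ℝ) (hT : 0 < T) (A : ℝ → Matrix (Fin n) (Fin n) ℂ)
    (hper : Function.Periodic A T)
    (hL2 : ∀ i j, MemLp (fun t => A t i j) 2 (volume.restrict (Set.Icc 0 T))) :
    (∃! Φ : ℝ → Matrix (Fin n) (Fin n) ℂ, Floquet.IsTransitionMatrix A Φ) ∧
    ∀ Φ : ℝ → Matrix (Fin n) (Fin n) ℂ, Floquet.IsTransitionMatrix A Φ →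
      (∃ (μ : Fin n → ℂ) (s : Fin n → Bool) (P : Matrix (Fin n) (Fin n) ℂ),
        Floquet.IsJordanBasis (Φ T) μ s P) ∧
      ∀ (μ : Fin n → ℂ) (s : Fin n → Bool) (P : Matrix (Fin n) (Fin n) ℂ),
        Floquet.IsJordanBasis (Φ T) μ s P →
        -- no eigenvalue vanishes, so the exponents are logarithms
        (∀ i, μ i ≠ 0) ∧
        -- the Jordan basis `P` can be normalized; the correction of a generalized eigenvector
        -- involves only earlier ones of its block, and the first two of a block are kept
        (∃ C : Matrix (Fin n) (Fin n) ℂ,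
          (∀ i, C i i = 1) ∧
          (∀ i j, i ≠ j → C i j ≠ 0 → Floquet.SameBlock s i j ∧
            ∃ k : Fin n, Floquet.SameBlock s k j ∧ (k : ℕ) + 2 ≤ j) ∧
          Floquet.IsNormalizedBasis T (Φ T) μ s (P * C)) ∧
        -- every normalized basis yields a Floquet factorization
        ∀ Ψ : Matrix (Fin n) (Fin n) ℂ, Floquet.IsNormalizedBasis T (Φ T) μ s Ψ →
          (∃! v : Fin n → ℝ → Fin n → ℂ, Floquet.IsFloquetSolution T A μ s Ψ v) ∧
          ∀ v : Fin n → ℝ → Fin n → ℂ, Floquet.IsFloquetSolution T A μ s Ψ v →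
          ∀ W : ℝ → Matrix (Fin n) (Fin n) ℂ, (∀ t i j, W t i j = v j t i) →
          ∀ Λ : Matrix (Fin n) (Fin n) ℂ, Λ = Floquet.floquetMatrix T μ s →
            -- periodicity, invertibility, absolute continuity
            (∀ j, Function.Periodic (v j) T) ∧
            Function.Periodic W T ∧
            (∀ t, IsUnit (W t).det) ∧
            Function.Periodic (fun t => (W t)⁻¹) T ∧
            (∀ i j, Floquet.LocAbsCont (fun t => W t i j)) ∧
            (∀ i j, Floquet.LocAbsCont (fun t => (W t)⁻¹ i j)) ∧
            -- the Floquet factorization `Φ(t,0) = W(t) e^{tΛ} W(0)⁻¹`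
            (∀ t : ℝ, Φ t = W t * NormedSpace.exp ((t : ℂ) • Λ) * (W 0)⁻¹) ∧
            -- the differential equations of `W` and `W⁻¹`
            (∀ᵐ t : ℝ, ∀ i j,
              HasDerivAt (fun τ => W τ i j) ((A t * W t - W t * Λ) i j) t) ∧
            (∀ᵐ t : ℝ, ∀ i j,
              HasDerivAt (fun τ => (W τ)⁻¹ i j) ((-((W t)⁻¹ * A t) + Λ * (W t)⁻¹) i j) t) ∧
            -- the eigenvalue problem on `ℓ²`
            (∃ 𝒲 : Floquet.EllTwo n ≃L[ℂ] Floquet.EllTwo n,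
              Floquet.IsMatrixOf (Floquet.blockToeplitz T W)
                (𝒲 : Floquet.EllTwo n →L[ℂ] Floquet.EllTwo n) ∧
              Floquet.conjugate 𝒲
                  (Floquet.matrixOperator (Floquet.blockToeplitz T A - Floquet.harmonicN n T)) =
                Floquet.matrixOperator
                  (Λ ⊗ₖ (1 : Matrix ℤ ℤ ℂ) - Floquet.harmonicN n T)) ∧
            -- reduction of `ẋ = A(t) x` to `ż = Λ z`
            (∀ x : ℝ → Fin n → ℂ, Floquet.IsSolution A x ↔
              Floquet.IsSolution (fun _ => Λ) (fun t => (W t)⁻¹ *ᵥ x t)) := by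
  have hA : ∀ i j, ∀ a b : ℝ, IntervalIntegrable (fun t => A t i j) volume a b := fun i j =>
    Floquet.intervalIntegrable_of_memLp_periodic hT (Floquet.periodic_entry hper i j) (hL2 i j)
  refine ⟨Floquet.existsUnique_isTransitionMatrix hA, fun Φ hΦ =>
    ⟨Floquet.exists_isJordanBasis (Φ T), fun μ s P hP => ?_⟩⟩
  have hdet : (Φ T).det ≠ 0 := by
    obtain ⟨Z, -, -, hZ⟩ := hΦ.exists_inverse hA
    exact (Matrix.isUnit_det_of_left_inverse (hZ T)).ne_zero
  have hμ := hP.eigenvalue_ne_zero hdet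
  refine ⟨hμ, Floquet.exists_isNormalizedBasis hT hP hμ, fun Ψ hΨ => ⟨?_, ?_⟩⟩
  · refine ⟨fun j t i => (Φ t * Ψ * NormedSpace.exp
      ((-(t : ℂ)) • Floquet.floquetMatrix T μ s)) i j, ?_, fun v hv => ?_⟩
    · exact (Floquet.isFloquetSolution_iff fun t i j => rfl).2
        ((hΦ.isMatPrimitive_floquet_iff hA).2 fun t => rfl)
    · have h := (hΦ.isMatPrimitive_floquet_iff hA (W := fun t => Matrix.of fun i j => v j t i)).1
        ((Floquet.isFloquetSolution_iff (W := fun t => Matrix.of fun i j => v j t i)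
          fun t i j => rfl).1 hv)
      funext j t i
      exact congrFun (congrFun (h t) i) j
  rintro v hv W hWv Λ rfl
  obtain ⟨hW0, hW⟩ := (Floquet.isFloquetSolution_iff hWv).1 hv
  have hWt := (hΦ.isMatPrimitive_floquet_iff hA).1 ⟨hW0, hW⟩
  obtain ⟨V, hV, hVW⟩ := hΦ.exists_floquet_inverse hA hΨ.1 hWt
  have hinv : ∀ t, (W t)⁻¹ = V t := fun t => Matrix.inv_eq_left_inv (hVW t)
  have hWper : Function.Periodic W T := by
    rw [funext hWt]
    exact hΦ.floquet_periodic hA hper hΨ.2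
  have hVper : Function.Periodic V T := fun t => by rw [← hinv, ← hinv, hWper t]
  simp only [hinv]
  refine ⟨fun j t => ?_, hWper, fun t => Matrix.isUnit_det_of_left_inverse (hVW t), hVper,
    fun i j => (hW i j).1, fun i j => (hV i j).1, fun t => ?_, hW.ae_hasDerivAt, ?_,
    Floquet.exists_harmonic_similarity hT hper hL2 hW hV hWper hVper hVW,
    Floquet.isSolution_iff_reduced hW hV hVW⟩
  · funext i
    rw [← hWv, ← hWv, hWper t]
  -- `W(0) = Ψ`, so `W(t) e^{tΛ} W(0)⁻¹` collapses to `Φ(t) Ψ Ψ⁻¹`.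
  · have h0 : Ψ * V 0 = 1 := by
      rw [← hW0]
      exact mul_eq_one_comm.1 (hVW 0)
    have he := Floquet.exp_smul_mul_exp_neg_smul (Floquet.floquetMatrix T μ s) (-(t : ℂ))
    rw [neg_neg] at he
    rw [hWt t, Matrix.mul_assoc (Φ t * Ψ), he, Matrix.mul_one, Matrix.mul_assoc, h0,
      Matrix.mul_one]
  · filter_upwards [hV.ae_hasDerivAt] with t ht i j
    rw [neg_add_eq_sub]
    exact ht i j
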